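/- Let $n\ge 2$ and let $\mathbb H$ be Hamilton's quaternion algebra. On the right $\mathbb H$-vector space $\mathbb H^{n+1}$, with coordinates $(z_0,z,z_n)\in\mathbb H\times\mathbb H^{n-1}\times\mathbb H$, consider the quaternionic Hermitian form $$q(z_0,z,z_n)=-\operatorname{tr}(\overline{z_0}\,z_n)+\operatorname{n}(z),$$ where $\operatorname{tr}(x)=x+\overline{x}$ and $\operatorname{n}(z)=\sum_{p=1}^{n-1}\overline{z_p}\,z_p$. In the right quaternionic projective space $\mathbb P^n_{\mathrm r}(\mathbb H)$, quaternionic hyperbolic $n$-space $\mathbf H^n_{\mathbb H}$ is the set of points with $q<0$, and its boundary at infinity $\partial_\infty\mathbf H^n_{\mathbb H}$ is the set of points with $q=0$. A chain is a set of the form $L\cap\partial_\infty\mathbf H^n_{\mathbb H}$, where $L$ is a quaternionic projective line of $\mathbb P^n_{\mathrm r}(\mathbb H)$ meeting $\mathbf H^n_{\mathbb H}$. Let $\mathrm U_q=\{g\in\mathrm{GL}_{n+1}(\mathbb H): q\circ g=q\}$ and $\mathrm{PU}_q=\mathrm U_q/\{\pm I_{n+1}\}$, which acts on $\mathbb P^n_{\mathrm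 r}(\mathbb H)$ through the left linear action of matrices on $\mathbb H^{n+1}$. If $f:\partial_\infty\mathbf H^n_{\mathbb H}\to\partial_\infty\mathbf H^n_{\mathbb H}$ is a bijection such that $f(C)$ is a chain for every chain $C$, then $f$ is the restriction to $\partial_\infty\mathbf H^n_{\mathbb H}$ of an element of $\mathrm{PU}_q$. -/

import Mathlib

open scoped Quaternion LinearAlgebra.Projectivization

namespace QuatHyp

/-- `ℍ^{n+1}`, with coordinates `(z_0, z_1, …, z_n)`. It is a right vector space over Hamilton's
quaternions, that is, a module over the opposite ring `ℍᵐᵒᵖ`, with `(v · a)_p = v_p * a`. -/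
abbrev V (n : ℕ) : Type := Fin (n + 1) → ℍ[ℝ]

/-- The right quaternionic projective space `P^n_r(ℍ)`. -/
abbrev P (n : ℕ) : Type := ℙ (ℍ[ℝ])ᵐᵒᵖ (V n)

/-- The reduced trace `tr x = x + x̄ = 2 Re x`, as a real number. -/
noncomputable def tr (x : ℍ[ℝ]) : ℝ := 2 * x.re

theorem coe_tr (x : ℍ[ℝ]) : ((tr x : ℝ) : ℍ[ℝ]) = x + star x := by
  rw [Quaternion.self_add_star, tr]; push_cast; rfl

/-- The quaternionic Hermitian form
`q (z_0, z, z_n) = - tr (z̄_0 z_n) + n(z)`, where `z = (z_1, …, z_{n-1})` and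
`n(z) = ∑_{0 < p < n} z̄_p z_p`. -/
noncomputable def q {n : ℕ} (v : V n) : ℝ :=
  - tr (star (v 0) * v (Fin.last n)) + ∑ p ∈ Finset.Ioo 0 (Fin.last n), Quaternion.normSq (v p)

theorem q_smul {n : ℕ} (a : (ℍ[ℝ])ᵐᵒᵖ) (v : V n) :
    q (a • v) = Quaternion.normSq a.unop * q v := by
  have h : ∀ x : ℍ[ℝ], (star a.unop * x * a.unop).re = Quaternion.normSq a.unop * x.re := by
    intro x
    simp [Quaternion.normSq_def']
    ring
  have h2 : star (v 0 * a.unop) * (v (Fin.last n) * a.unop)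
      = star a.unop * (star (v 0) * v (Fin.last n)) * a.unop := by
    simp [mul_assoc]
  simp only [q, tr, Pi.smul_apply, MulOpposite.smul_eq_mul_unop, h2, h, map_mul]
  rw [mul_add, Finset.mul_sum]
  congr 1
  · ring
  · exact Finset.sum_congr rfl fun _ _ => mul_comm _ _

/-- Quaternionic hyperbolic `n`-space in its projective model: the negative cone of `q`, that is,
the projective points some (equivalently, every) representative vector of which satisfies
`q < 0`. -/
def hyperbolicSpace (n : ℕ) : Set (P n) := {x | q x.rep < 0}

/-- The boundary at infinity of quaternionic hyperbolic `n`-space: the isotropic cone of `q`. -/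
def boundary (n : ℕ) : Set (P n) := {x | q x.rep = 0}

theorem q_mk_rep {n : ℕ} (v : V n) (hv : v ≠ 0) :
    ∃ t : ℝ, 0 < t ∧ q (Projectivization.mk (ℍ[ℝ])ᵐᵒᵖ v hv).rep = t * q v := by
  obtain ⟨a, ha⟩ := Projectivization.exists_smul_eq_mk_rep (ℍ[ℝ])ᵐᵒᵖ v hv
  refine ⟨Quaternion.normSq (a : (ℍ[ℝ])ᵐᵒᵖ).unop, ?_, ?_⟩
  · refine lt_of_le_of_ne Quaternion.normSq_nonneg (Ne.symm ?_)
    simp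
  · rw [← ha]
    exact q_smul _ _

theorem mk_mem_hyperbolicSpace {n : ℕ} (v : V n) (hv : v ≠ 0) :
    Projectivization.mk (ℍ[ℝ])ᵐᵒᵖ v hv ∈ hyperbolicSpace n ↔ q v < 0 := by
  obtain ⟨t, ht, h⟩ := q_mk_rep v hv
  change q _ < 0 ↔ _
  rw [h, mul_neg_iff]
  constructor
  · rintro (⟨_, h1⟩ | ⟨h1, _⟩)
    · exact h1
    · exact absurd h1 ht.le.not_gt
  · exact fun h1 => Or.inl ⟨ht, h1⟩

theorem mk_mem_boundary {n : ℕ} (v : V n) (hv : v ≠ 0) :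
    Projectivization.mk (ℍ[ℝ])ᵐᵒᵖ v hv ∈ boundary n ↔ q v = 0 := by
  obtain ⟨t, ht, h⟩ := q_mk_rep v hv
  simp [boundary, h, ht.ne']

/-- The set of projective points lying on the projective subspace defined by a right vector
subspace `W` of `ℍ^{n+1}`; the dimension of this projective subspace is `dim W - 1`. -/
def points {n : ℕ} (W : Submodule (ℍ[ℝ])ᵐᵒᵖ (V n)) : Set (P n) := {x | x.submodule ≤ W}

/-- An `m`-chain: the intersection with the boundary at infinity of a quaternionic projective
subspace of dimension `m` which meets quaternionic hyperbolic space. -/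
def IsMChain {n : ℕ} (m : ℕ) (C : Set (boundary n)) : Prop :=
  ∃ W : Submodule (ℍ[ℝ])ᵐᵒᵖ (V n), Module.finrank (ℍ[ℝ])ᵐᵒᵖ W = m + 1 ∧
    (points W ∩ hyperbolicSpace n).Nonempty ∧ C = {x : boundary n | (x : P n) ∈ points W}

/-- A chain is a `1`-chain: it is cut out by a quaternionic projective line. -/
def IsChain {n : ℕ} (C : Set (boundary n)) : Prop := IsMChain 1 C

/-- The unitary group `U_q = {g ∈ GL_{n+1}(ℍ) : q ∘ g = q}`. -/
def U (n : ℕ) : Subgroup (GL (Fin (n + 1)) ℍ[ℝ]) where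
  carrier := {g | ∀ v : V n, q ((g : Matrix (Fin (n + 1)) (Fin (n + 1)) ℍ[ℝ]).mulVec v) = q v}
  one_mem' := fun v => by simp
  mul_mem' := fun {a b} ha hb v => by
    rw [Units.val_mul, ← Matrix.mulVec_mulVec, ha, hb]
  inv_mem' := fun {a} ha v => by
    rw [← ha, Matrix.mulVec_mulVec, ← Units.val_mul]
    simp

/-- `- I_{n+1}` as an element of `U_q`. -/
noncomputable def negOne (n : ℕ) : U n := ⟨-1, fun v => by simp [q, Matrix.neg_mulVec]⟩

/-- The subgroup `{± I_{n+1}}` of `U_q`. -/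
def pm (n : ℕ) : Subgroup (U n) where
  carrier := {1, negOne n}
  one_mem' := Or.inl rfl
  mul_mem' := by
    have h : negOne n * negOne n = 1 := Subtype.ext (by simp [negOne])
    rintro a b (rfl | rfl) (rfl | rfl) <;> simp [h]
  inv_mem' := by
    have h : (negOne n)⁻¹ = negOne n := Subtype.ext (by simp [negOne])
    rintro a (rfl | rfl) <;> simp [h]

instance (n : ℕ) : (pm n).Normal where
  conj_mem := by
    rintro a (rfl | rfl) g
    · left; simp
    · right; exact Subtype.ext (by simp [negOne])

/-- The projective unitary group `PU_q = U_q / {± I_{n+1}}`. -/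
abbrev PU (n : ℕ) : Type := U n ⧸ pm n

/-- The action of `PU_q` on the projective space `P^n_r(ℍ)`, induced by the left linear action of
matrices on `ℍ^{n+1}`. -/
noncomputable def projAction (n : ℕ) : PU n →* Equiv.Perm (P n) :=
  QuotientGroup.lift (pm n) ((MulAction.toPermHom (GL (Fin (n + 1)) ℍ[ℝ]) (P n)).comp (U n).subtype)
    (by
      rintro a (rfl | rfl)
      · simp
      · ext x
        induction x using Projectivization.ind with | h v hv
        simp only [MonoidHom.comp_apply, MulAction.toPermHom_apply, MulAction.toPerm_apply,
          Subgroup.coe_subtype, Equiv.Perm.coe_one, id_eq, Projectivization.smul_mk]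
        rw [Projectivization.mk_eq_mk_iff']
        refine ⟨-1, ?_⟩
        simp [negOne, Units.smul_def])

/-- The class of the matrix `g` maps the point with homogeneous coordinates `v` to the point with
homogeneous coordinates `g v`. -/
theorem projAction_mk {n : ℕ} (g : U n) (v w : V n) (hv : v ≠ 0) (hw : w ≠ 0)
    (h : w = ((g : GL (Fin (n + 1)) ℍ[ℝ]) : Matrix (Fin (n + 1)) (Fin (n + 1)) ℍ[ℝ]).mulVec v) :
    projAction n (g : PU n) (Projectivization.mk (ℍ[ℝ])ᵐᵒᵖ v hv) =
      Projectivization.mk (ℍ[ℝ])ᵐᵒᵖ w hw := by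
  subst h
  rfl

end QuatHyp

/-! The group `U n` preserves chains and acts transitively on the boundary, and Heisenberg
translations fix `inf` and carry the origin `pt 0 0` to any other finite point. So `f` may be
composed with group elements until it fixes both `inf` and `pt 0 0`.

A boundary point other than `inf` has a horizontal coordinate `w` in `ℍ^m` and an imaginary height
`v.im`. Chains through `inf` are the fibres of the projection to `w`. Any other chain projects
bijectively onto a round sphere in a quaternionic affine line, and if `ζ` is the centre of that
sphere, heights above `w` and `w'` differ by `(herm ζ (w - w')).im`
(`IsChain.eq_vchain_or_eq_fchain`). Two points determine a chain, so the inverse of `f` preserves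
chains as well, and `f` induces a bijection `F` of `ℍ^m` preserving these spheres in both
directions.

Two ideas then determine `F`. First, the centre of a sphere can be recognised from incidence with
spheres alone (`center_iff`), so `F` respects centres and antipodes, hence midpoints, and is
additive once it fixes `0`. Second, the height law holds around `ζ` before applying `f` and around
`F ζ` after (`im_sub_eq`). With `ζ` on the line `w ℍ` this links the action on heights to the
scalars by which `F` acts on that line (`map_smul_eq`). Since the action on heights does not depend
on `w`, one obtains `F (w s) = F w * g s` for a single ring endomorphism `g` of `ℍ` fixing the
reals. It is inner (`exists_conj`), so `F` followed by right multiplication by a unit quaternion is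
linear and scales the norm, and `exists_bdAction_similarity` realises `f` in `U (m + 1)`. -/

namespace QuatHyp

open scoped RightActions
open Quaternion

variable {m n : ℕ}

/-! ### Quaternion units and the Hermitian product on `ℍ^m`. -/

/-- The right quaternionic vector space `ℍ^m`, the space of middle coordinates of `V (m + 1)`. -/
abbrev W (m : ℕ) : Type := Fin m → ℍ[ℝ]

/-- The quaternion unit `i`. -/
def qi : ℍ[ℝ] := ⟨0, 1, 0, 0⟩

/-- The quaternion unit `j`. -/
def qj : ℍ[ℝ] := ⟨0, 0, 1, 0⟩

/-- The quaternion unit `k`. -/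
def qk : ℍ[ℝ] := ⟨0, 0, 0, 1⟩

@[simp] theorem re_qi : qi.re = 0 := rfl
@[simp] theorem imI_qi : qi.imI = 1 := rfl
@[simp] theorem imJ_qi : qi.imJ = 0 := rfl
@[simp] theorem imK_qi : qi.imK = 0 := rfl
@[simp] theorem re_qj : qj.re = 0 := rfl
@[simp] theorem imI_qj : qj.imI = 0 := rfl
@[simp] theorem imJ_qj : qj.imJ = 1 := rfl
@[simp] theorem imK_qj : qj.imK = 0 := rfl
@[simp] theorem re_qk : qk.re = 0 := rfl
@[simp] theorem imI_qk : qk.imI = 0 := rfl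
@[simp] theorem imJ_qk : qk.imJ = 0 := rfl
@[simp] theorem imK_qk : qk.imK = 1 := rfl

theorem normSq_qi : normSq qi = 1 := by simp [normSq_def']

/-- The standard Hermitian product on `ℍ^m`, linear on the right in the second variable. -/
noncomputable def herm (x y : W m) : ℍ[ℝ] := ∑ i, star (x i) * y i

/-- The standard quadratic norm on `ℍ^m`. -/
noncomputable def nsq (x : W m) : ℝ := ∑ i, normSq (x i)

theorem herm_add_left (x y z : W m) : herm (x + y) z = herm x z + herm y z := by
  simp [herm, add_mul, Finset.sum_add_distrib]

theorem herm_add_right (x y z : W m) : herm x (y + z) = herm x y + herm x z := by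
  simp [herm, mul_add, Finset.sum_add_distrib]

theorem herm_neg_left (x y : W m) : herm (-x) y = -herm x y := by simp [herm]

theorem herm_neg_right (x y : W m) : herm x (-y) = -herm x y := by simp [herm]

theorem herm_sub_right (x y z : W m) : herm x (y - z) = herm x y - herm x z := by
  simp [sub_eq_add_neg, herm_add_right, herm_neg_right]

@[simp] theorem herm_zero_left (x : W m) : herm 0 x = 0 := by simp [herm]

@[simp] theorem herm_zero_right (x : W m) : herm x 0 = 0 := by simp [herm]

theorem herm_smul_right (x y : W m) (s : ℍ[ℝ]) : herm x (y <• s) = herm x y * s := by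
  simp [herm, Finset.sum_mul, mul_assoc]

theorem herm_smul_left (x y : W m) (s : ℍ[ℝ]) : herm (x <• s) y = star s * herm x y := by
  simp [herm, Finset.mul_sum, mul_assoc]

theorem star_herm (x y : W m) : star (herm x y) = herm y x := by simp [herm]

theorem herm_self (x : W m) : herm x x = (nsq x : ℝ) := by
  rw [herm, nsq, ← algebraMap_def, map_sum]
  exact Finset.sum_congr rfl fun i _ => star_mul_self _

theorem nsq_smul (x : W m) (s : ℍ[ℝ]) : nsq (x <• s) = nsq x * normSq s := by
  simp [nsq, Finset.sum_mul]

@[simp] theorem nsq_zero : nsq (0 : W m) = 0 := by simp [nsq]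

@[simp] theorem nsq_neg (x : W m) : nsq (-x) = nsq x := by simp [nsq]

theorem nsq_nonneg (x : W m) : 0 ≤ nsq x := Finset.sum_nonneg fun _ _ => normSq_nonneg

theorem nsq_eq_zero {x : W m} : nsq x = 0 ↔ x = 0 := by
  rw [nsq, Finset.sum_eq_zero_iff_of_nonneg fun _ _ => normSq_nonneg]
  simp [funext_iff]

theorem nsq_pos {x : W m} (hx : x ≠ 0) : 0 < nsq x :=
  (nsq_nonneg x).lt_of_ne fun h => hx (nsq_eq_zero.1 h.symm)

theorem nsq_add (x y : W m) : nsq (x + y) = nsq x + nsq y + 2 * (herm x y).re := by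
  have h : ((nsq (x + y) : ℝ) : ℍ[ℝ]) = nsq x + nsq y + (herm x y + star (herm x y)) := by
    rw [star_herm, ← herm_self, ← herm_self, ← herm_self, herm_add_left, herm_add_right,
      herm_add_right]
    abel
  have := congrArg (fun z : ℍ[ℝ] => z.re) h
  simpa [two_mul] using this

theorem smul_left_cancel {u : W m} (hu : u ≠ 0) {s t : ℍ[ℝ]} (h : u <• s = u <• t) : s = t := by
  obtain ⟨i, hi⟩ := Function.ne_iff.1 hu
  have := congrFun h i
  exact mul_left_cancel₀ hi this

theorem smul_ne_zero_of {u : W m} (hu : u ≠ 0) {s : ℍ[ℝ]} (hs : s ≠ 0) : u <• s ≠ 0 :=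
  fun h => hs (smul_left_cancel hu (by simpa using h))

theorem re_mul_coe (a : ℍ[ℝ]) (t : ℝ) : (a * (t : ℍ[ℝ])).re = a.re * t := by
  simp [re_mul]

theorem normSq_add_re (a b : ℍ[ℝ]) :
    normSq (a + b) = normSq a + normSq b + 2 * (star a * b).re := by
  simp only [normSq_def', re_add, imI_add, imJ_add, imK_add, re_mul, re_star, imI_star, imJ_star,
    imK_star]
  ring

/-! ### Spheres in quaternionic lines. -/

/-- The round sphere with centre `ζ` through `ζ + u` in the quaternionic line `ζ + u ℍ`. -/
def sph (ζ u : W m) : Set (W m) := {x | ∃ s : ℍ[ℝ], normSq s = 1 ∧ x = ζ + u <• s}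

theorem sph_smul (ζ u : W m) {s : ℍ[ℝ]} (hs : normSq s = 1) : sph ζ (u <• s) = sph ζ u := by
  have hs0 : s ≠ 0 := by rintro rfl; simp at hs
  ext x
  constructor
  · rintro ⟨t, ht, rfl⟩
    exact ⟨s * t, by simp [hs, ht], by rw [op_smul_op_smul]⟩
  · rintro ⟨t, ht, rfl⟩
    exact ⟨s⁻¹ * t, by simp [hs, ht], by rw [op_smul_op_smul, mul_inv_cancel_left₀ hs0]⟩

theorem add_mem_sph (ζ u : W m) : ζ + u ∈ sph ζ u := ⟨1, by simp, by simp⟩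

theorem sub_mem_sph (ζ u : W m) : ζ - u ∈ sph ζ u := ⟨-1, by simp, by simp [sub_eq_add_neg]⟩

theorem sph_neg (ζ u : W m) : sph ζ (-u) = sph ζ u := by
  have := sph_smul ζ u (s := -1) (by simp)
  simpa using this

theorem exists_of_mem_sph {ζ u x : W m} (hu : u ≠ 0) (hx : x ∈ sph ζ u) :
    ∃ p : W m, p ≠ 0 ∧ x = ζ + p ∧ sph ζ p = sph ζ u := by
  obtain ⟨s, hs, rfl⟩ := hx
  exact ⟨u <• s, smul_ne_zero_of hu (by rintro rfl; simp at hs), rfl, sph_smul ζ u hs⟩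

theorem nsq_sub_of_mem_sph {ζ u x : W m} (hx : x ∈ sph ζ u) : nsq (x - ζ) = nsq u := by
  obtain ⟨s, hs, rfl⟩ := hx
  simp [nsq_smul, hs]

/-- Three points lie on a common sphere contained in a quaternionic line. -/
def Cosph (x y z : W m) : Prop := ∃ ζ u : W m, u ≠ 0 ∧ x ∈ sph ζ u ∧ y ∈ sph ζ u ∧ z ∈ sph ζ u

theorem exists_eq_of_cosph {x y z : W m} (h : Cosph x y z) (hxy : x ≠ y) :
    ∃ r : ℍ[ℝ], z = x + (y - x) <• r := by
  obtain ⟨ζ, u, -, ⟨a, -, rfl⟩, ⟨b, -, rfl⟩, ⟨c, -, rfl⟩⟩ := h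
  have hab : b - a ≠ 0 := by
    intro h
    rw [sub_eq_zero.1 h] at hxy
    exact hxy rfl
  refine ⟨(b - a)⁻¹ * (c - a), ?_⟩
  have : ζ + u <• b - (ζ + u <• a) = u <• (b - a) := by
    rw [MulOpposite.op_sub, sub_smul]; abel
  rw [this, op_smul_op_smul, mul_inv_cancel_left₀ hab, MulOpposite.op_sub, sub_smul]
  abel

theorem nsq_add_coe_smul (x d : W m) (t : ℝ) :
    nsq (x + d <• (t : ℍ[ℝ])) = nsq x + t ^ 2 * nsq d + t * (2 * (herm x d).re) := by
  rw [nsq_add, nsq_smul, herm_smul_right, normSq_coe, re_mul]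
  simp
  ring

/-- The squared distance to the centre is a quadratic polynomial along a real line, so the line
meets a sphere at most twice. -/
theorem eq_zero_or_one_of_cosph {x y : W m} (hxy : x ≠ y) {t : ℝ}
    (h : Cosph x y (x + (y - x) <• (t : ℍ[ℝ]))) : t = 0 ∨ t = 1 := by
  obtain ⟨ζ, u, -, h1, h2, h3⟩ := h
  have hd : nsq (y - x) ≠ 0 := fun h => hxy (sub_eq_zero.1 (nsq_eq_zero.1 h)).symm
  have e1 := nsq_sub_of_mem_sph h1
  have e2 := nsq_sub_of_mem_sph h2
  have e3 := nsq_sub_of_mem_sph h3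
  have h2' : y - ζ = (x - ζ) + (y - x) <• ((1 : ℝ) : ℍ[ℝ]) := by simp
  rw [h2', nsq_add_coe_smul] at e2
  rw [add_sub_right_comm, nsq_add_coe_smul] at e3
  have : t * (t - 1) * nsq (y - x) = 0 := by linear_combination e3 - t * e2 - (1 - t) * e1
  rcases mul_eq_zero.1 ((mul_eq_zero.1 this).resolve_right hd) with h | h
  · exact Or.inl h
  · exact Or.inr (by linarith)

/-- Within one quaternionic line, three points not on a real line have a circumcentre. In the
coordinate taking `a`, `b`, `c` to `0`, `1`, `s`, it may be sought in the real plane spanned by `1`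
and `s.im`. -/
theorem cosph_of_not_collinear (ζ : W m) {p : W m} (hp : p ≠ 0) {a b c : ℍ[ℝ]} (hab : a ≠ b)
    (hc : ∀ t : ℝ, c - a ≠ (b - a) * t) : Cosph (ζ + p <• a) (ζ + p <• b) (ζ + p <• c) := by
  have hba : b - a ≠ 0 := sub_ne_zero.2 hab.symm
  obtain ⟨s, hs⟩ : ∃ s, c - a = (b - a) * s :=
    ⟨(b - a)⁻¹ * (c - a), by rw [mul_inv_cancel_left₀ hba]⟩
  have him : normSq s.im ≠ 0 := by
    intro h
    rw [normSq_eq_zero] at h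
    refine hc s.re ?_
    rw [hs]
    congr 1
    conv_lhs => rw [← re_add_im s, h, add_zero]
  -- This is the equation `normSq (s - e) = normSq e` for `e = 1/2 + β • s.im`; such an `e` is
  -- equidistant from `0` and `1` for every `β`.
  obtain ⟨β, hβ⟩ : ∃ β : ℝ, 2 * (s.re / 2 + β * normSq s.im) = normSq s :=
    ⟨(normSq s - s.re) / (2 * normSq s.im), by field_simp; ring⟩
  set e : ℍ[ℝ] := ((1 / 2 : ℝ) : ℍ[ℝ]) + β • s.im with he
  have he0 : e ≠ 0 := by
    intro h
    have : e.re = 0 := by rw [h, re_zero]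
    rw [he, re_add, re_coe, re_smul, re_im, smul_zero] at this
    norm_num at this
  have h1 : normSq (1 - e) = normSq e := by
    simp only [normSq_def', he, re_sub, imI_sub, imJ_sub, imK_sub, re_add, imI_add, imJ_add,
      imK_add, re_coe, imI_coe, imJ_coe, imK_coe, re_smul, imI_smul, imJ_smul, imK_smul, re_im,
      imI_im, imJ_im, imK_im, re_one, imI_one, imJ_one, imK_one, smul_eq_mul]
    ring
  have h2 : normSq (s - e) = normSq e := by
    simp only [normSq_def', he, re_sub, imI_sub, imJ_sub, imK_sub, re_add, imI_add, imJ_add,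
      imK_add, re_coe, imI_coe, imJ_coe, imK_coe, re_smul, imI_smul, imJ_smul, imK_smul, re_im,
      imI_im, imJ_im, imK_im, smul_eq_mul] at hβ ⊢
    linear_combination -hβ
  have hne : normSq e ≠ 0 := normSq_ne_zero.2 he0
  have key : ∀ r : ℍ[ℝ], normSq (r - e) = normSq e →
      ζ + p <• (a + (b - a) * r) ∈ sph (ζ + p <• (a + (b - a) * e)) (p <• ((b - a) * e)) := by
    intro r hr
    refine ⟨e⁻¹ * (r - e), ?_, ?_⟩
    · simp only [map_mul, map_inv₀, hr]
      exact inv_mul_cancel₀ hne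
    · rw [op_smul_op_smul, add_assoc, ← add_smul, ← MulOpposite.op_add, mul_assoc,
        mul_inv_cancel_left₀ he0]
      congr 3
      noncomm_ring
  refine ⟨ζ + p <• (a + (b - a) * e), p <• ((b - a) * e),
    smul_ne_zero_of hp (mul_ne_zero hba he0), ?_, ?_, ?_⟩
  · simpa using key 0 (by simp)
  · simpa using key 1 h1
  · have := key s h2
    rwa [← hs, add_sub_cancel] at this

theorem Cosph.rotate {x y z : W m} (h : Cosph x y z) : Cosph y z x := by
  obtain ⟨ζ, u, hu, h1, h2, h3⟩ := h
  exact ⟨ζ, u, hu, h2, h3, h1⟩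

/-! ### Tangency, antipodes and centres expressed by incidence. -/

/-- The point `z` lies on the tangent hyperplane at `x` of the sphere `S`, within the quaternionic
line carrying `S`. -/
def Tangent (z x : W m) (S : Set (W m)) : Prop := z ∉ S ∧ ∀ s ∈ S, s ≠ x → Cosph z x s

/-- If `z` were off the tangent hyperplane, the real line through `x` and `z` would meet the sphere
again, in a point collinear with both and so not cospherical with them. -/
theorem Tangent.re_eq_one {ζ p : W m} (hp : p ≠ 0) {r : ℍ[ℝ]}
    (h : Tangent (ζ + p <• r) (ζ + p) (sph ζ p)) : r.re = 1 := by
  by_contra hr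
  have hr1 : r - 1 ≠ 0 := by
    intro h
    rw [sub_eq_zero.1 h] at hr
    simp at hr
  have hn : normSq (r - 1) ≠ 0 := normSq_ne_zero.2 hr1
  -- Chosen so that `1 + (r - 1) * t` has norm one: the second intersection of that real line with
  -- the sphere.
  obtain ⟨t, ht⟩ : ∃ t : ℝ, t * normSq (r - 1) = -2 * (r.re - 1) :=
    ⟨-2 * (r.re - 1) / normSq (r - 1), by field_simp⟩
  have ht0 : t ≠ 0 := by
    rintro rfl
    apply hr
    linarith
  have hs : normSq (1 + (r - 1) * (t : ℍ[ℝ])) = 1 := by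
    rw [normSq_add_re, map_mul, normSq_coe, star_one, one_mul, re_mul_coe, re_sub, re_one, map_one]
    linear_combination t * ht
  have hmem : ζ + p <• (1 + (r - 1) * (t : ℍ[ℝ])) ∈ sph ζ p := ⟨_, hs, rfl⟩
  have hne : ζ + p <• (1 + (r - 1) * (t : ℍ[ℝ])) ≠ ζ + p := by
    intro h
    have h' : 1 + (r - 1) * (t : ℍ[ℝ]) = 1 :=
      smul_left_cancel hp (by rw [add_left_cancel h, MulOpposite.op_one, one_smul])
    rw [add_eq_left, mul_eq_zero] at h'
    rcases h' with h' | h'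
    · exact hr1 h'
    · exact ht0 (coe_injective h')
  have hc := (h.2 _ hmem hne)
  obtain ⟨ξ, u, hu, h1, h2, h3⟩ := hc
  have hzx : ζ + p ≠ ζ + p <• r := by
    intro h
    exact hr1 (sub_eq_zero.2 (smul_left_cancel hp (t := 1) (by simpa using h.symm)))
  have hc' : Cosph (ζ + p) (ζ + p <• r) (ζ + p + (ζ + p <• r - (ζ + p)) <• (t : ℍ[ℝ])) := by
    refine ⟨ξ, u, hu, h2, h1, ?_⟩
    convert h3 using 1
    rw [add_sub_add_left_eq_sub, MulOpposite.op_add, add_smul, MulOpposite.op_one, one_smul,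
      ← op_smul_op_smul, MulOpposite.op_sub, sub_smul, MulOpposite.op_one, one_smul, add_assoc]
  rcases eq_zero_or_one_of_cosph hzx hc' with h' | h'
  · exact ht0 h'
  · apply h.1
    rw [h'] at hmem
    simpa using hmem

theorem tangent_of_re_eq_one {ζ p : W m} (hp : p ≠ 0) {r : ℍ[ℝ]} (hr : r.re = 1) (hr1 : r ≠ 1) :
    Tangent (ζ + p <• r) (ζ + p) (sph ζ p) := by
  have hr1' : r - 1 ≠ 0 := sub_ne_zero.2 hr1
  have hn : 0 < normSq (r - 1) := normSq_nonneg.lt_of_ne (normSq_ne_zero.2 hr1').symm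
  have key : ∀ t : ℝ, normSq (1 + (r - 1) * (t : ℍ[ℝ])) = 1 + t ^ 2 * normSq (r - 1) := by
    intro t
    rw [normSq_add_re, map_mul, normSq_coe, star_one, one_mul, re_mul_coe, re_sub, re_one, map_one,
      hr]
    ring
  constructor
  · rintro ⟨s, hs, h⟩
    have h' := smul_left_cancel hp (by simpa using h)
    have := key 1
    rw [← h'] at hs
    simp [hs] at this
    exact hr1' this
  · rintro _ ⟨s, hs, rfl⟩ hne
    have := cosph_of_not_collinear ζ hp (a := r) (b := 1) (c := s) hr1 ?_
    · simpa using this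
    · intro t ht
      have hs' : s = 1 + (r - 1) * ((1 - t : ℝ) : ℍ[ℝ]) := by
        rw [← sub_add_cancel s r, ht]
        push_cast
        noncomm_ring
      rw [hs', key] at hs
      have h0 : (1 - t) ^ 2 = 0 := by
        rcases mul_eq_zero.1 (show (1 - t) ^ 2 * normSq (r - 1) = 0 by linarith) with h | h
        · exact h
        · exact absurd h hn.ne'
      have h1 : 1 - t = 0 := pow_eq_zero_iff (two_ne_zero) |>.1 h0
      rw [hs', h1] at hne
      simp at hne

theorem sub_ne_add (ζ : W m) {p : W m} (hp : p ≠ 0) : ζ - p ≠ ζ + p := by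
  intro h
  have h2 : p <• (-1 : ℍ[ℝ]) = p <• (1 : ℍ[ℝ]) := by
    rw [MulOpposite.op_neg, neg_smul, MulOpposite.op_one, one_smul]
    rw [sub_eq_add_neg] at h
    exact add_left_cancel h
  have := congrArg (fun z : ℍ[ℝ] => z.re) (smul_left_cancel hp h2)
  norm_num at this

/-- The points `x` and `y` of the sphere `S` are antipodal, in terms of incidence with spheres. -/
def Antipodal (x y : W m) (S : Set (W m)) : Prop :=
  x ∈ S ∧ y ∈ S ∧ x ≠ y ∧ ∀ z, ¬(Tangent z x S ∧ Tangent z y S)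

/-- Tangent hyperplanes at two distinct points of a sphere are parallel precisely when the points
are opposite; otherwise they have a common point. -/
theorem antipodal_iff {ζ p y : W m} (hp : p ≠ 0) :
    Antipodal (ζ + p) y (sph ζ p) ↔ y = ζ - p := by
  constructor
  · rintro ⟨-, ⟨s, hs, rfl⟩, hne, h⟩
    by_contra hne'
    have hs1 : s ≠ 1 := by rintro rfl; simp at hne
    have hs2 : s ≠ -1 := by rintro rfl; simp [sub_eq_add_neg] at hne'
    have hs0 : s ≠ 0 := by rintro rfl; simp at hs
    have hsd : s.re ^ 2 + s.imI ^ 2 + s.imJ ^ 2 + s.imK ^ 2 = 1 := by rw [← normSq_def', hs]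
    have hlt : s.re ^ 2 ≠ 1 := by
      intro h1
      have hI : s.imI = 0 := by
        nlinarith [sq_nonneg s.imI, sq_nonneg s.imJ, sq_nonneg s.imK]
      have hJ : s.imJ = 0 := by
        nlinarith [sq_nonneg s.imI, sq_nonneg s.imJ, sq_nonneg s.imK]
      have hK : s.imK = 0 := by
        nlinarith [sq_nonneg s.imI, sq_nonneg s.imJ, sq_nonneg s.imK]
      rcases (sq_eq_sq_iff_eq_or_eq_neg.1 (h1.trans (one_pow 2).symm)) with h2 | h2
      · exact hs1 (by ext <;> simp [*])
      · exact hs2 (by ext <;> simp [*])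
    have hd : 1 + s.re ≠ 0 := fun h => hlt (by rw [show s.re = -1 by linarith]; norm_num)
    have hr1 : ∀ e : ℍ[ℝ], normSq e = 1 → (1 + s) * (((1 + s.re)⁻¹ : ℝ) : ℍ[ℝ]) ≠ e := by
      intro e he h
      have h3 := congrArg normSq h
      rw [map_mul, normSq_coe, he, normSq_add_re, hs] at h3
      simp at h3
      field_simp at h3
      apply hlt
      linarith
    -- This point lies on both tangent hyperplanes `re r = 1` and `re (star s * r) = 1`, on the real
    -- line through `1 + s`.
    refine h (ζ + p <• ((1 + s) * (((1 + s.re)⁻¹ : ℝ) : ℍ[ℝ]))) ⟨?_, ?_⟩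
    · apply tangent_of_re_eq_one hp
      · rw [re_mul_coe, re_add, re_one, mul_inv_cancel₀ hd]
      · exact hr1 1 (by simp)
    · rw [← sph_smul ζ p hs]
      have : p <• ((1 + s) * (((1 + s.re)⁻¹ : ℝ) : ℍ[ℝ]))
          = (p <• s) <• (star s * ((1 + s) * (((1 + s.re)⁻¹ : ℝ) : ℍ[ℝ]))) := by
        rw [op_smul_op_smul, ← mul_assoc s, self_mul_star, hs, coe_one, one_mul]
      rw [this]
      apply tangent_of_re_eq_one (smul_ne_zero_of hp hs0)
      · rw [← mul_assoc, re_mul_coe, mul_add, star_mul_self, hs, mul_one, re_add, re_star, coe_one,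
          re_one, add_comm s.re, mul_inv_cancel₀ hd]
      · intro h
        apply hr1 s hs
        have := congrArg (s * ·) h
        simpa [← mul_assoc, self_mul_star, hs] using this
  · rintro rfl
    refine ⟨add_mem_sph _ _, sub_mem_sph _ _, (sub_ne_add ζ hp).symm, ?_⟩
    · rintro z ⟨h1, h2⟩
      have hne : ζ - p ≠ ζ + p := sub_ne_add ζ hp
      obtain ⟨r, rfl⟩ : ∃ r : ℍ[ℝ], z = ζ + p <• r := by
        obtain ⟨r, hr⟩ := exists_eq_of_cosph (h1.2 _ (sub_mem_sph ζ p) hne).rotate hne.symm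
        refine ⟨1 - (r + r), ?_⟩
        rw [hr, show ζ - p - (ζ + p) = -(p + p) by abel, smul_neg, smul_add, MulOpposite.op_sub,
          sub_smul, MulOpposite.op_add, add_smul, MulOpposite.op_one, one_smul]
        abel
      have e1 := h1.re_eq_one hp
      have e2 : (-r).re = 1 := by
        apply Tangent.re_eq_one (ζ := ζ) (neg_ne_zero.2 hp)
        rw [sph_neg]
        simpa [sub_eq_add_neg] using h2
      rw [re_neg, e1] at e2
      norm_num at e2

/-- The point `z` is the centre of the sphere `S`, in terms of incidence with spheres. -/
def Center (z : W m) (S : Set (W m)) : Prop :=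
  (∃ s ∈ S, ∃ s' ∈ S, s ≠ s' ∧ Cosph z s s') ∧ ∀ x y, Antipodal x y S → ¬Cosph z x y

/-- Cosphericity with two distinct points of the sphere puts `z` in its quaternionic line. There the
centre is the only point collinear with every antipodal pair, and collinear triples of distinct
points are never cospherical. -/
theorem center_iff {ζ p z : W m} (hp : p ≠ 0) : Center z (sph ζ p) ↔ z = ζ := by
  constructor
  · rintro ⟨⟨_, ⟨s, -, rfl⟩, _, ⟨s', -, rfl⟩, hne, hc⟩, h⟩
    obtain ⟨r, rfl⟩ : ∃ r : ℍ[ℝ], z = ζ + p <• r := by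
      obtain ⟨r, hr⟩ := exists_eq_of_cosph hc.rotate hne
      refine ⟨s + (s' - s) * r, ?_⟩
      rw [hr, add_sub_add_left_eq_sub, MulOpposite.op_add, add_smul, ← op_smul_op_smul,
        MulOpposite.op_sub, sub_smul, add_assoc]
    by_contra hr
    have hr0 : r ≠ 0 := by rintro rfl; simp at hr
    -- A diameter whose real line misses `r`: the direction `1` serves unless `r` is real, and then
    -- `qi` does.
    obtain ⟨s, hs, hsr⟩ : ∃ s : ℍ[ℝ], normSq s = 1 ∧ ∀ t : ℝ, r ≠ s * (t : ℍ[ℝ]) := by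
      by_cases h1 : ∀ t : ℝ, r ≠ 1 * (t : ℍ[ℝ])
      · exact ⟨1, by simp, h1⟩
      · push Not at h1
        obtain ⟨t, ht⟩ := h1
        refine ⟨qi, normSq_qi, ?_⟩
        rintro t' ht'
        rw [ht] at ht'
        have := congrArg (fun z : ℍ[ℝ] => z.re) ht'
        rw [re_mul_coe, re_mul_coe] at this
        simp at this
        rw [this] at ht
        simp at ht
        exact hr0 ht
    have hs0 : s ≠ 0 := by rintro rfl; simp at hs
    have hps := smul_ne_zero_of hp hs0
    refine h (ζ + p <• s) (ζ - p <• s) ?_ ?_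
    · rw [← sph_smul ζ p hs]
      exact (antipodal_iff hps).2 rfl
    · have := cosph_of_not_collinear ζ hp (a := s) (b := -s) (c := r) ?_ ?_
      · rw [MulOpposite.op_neg, neg_smul, ← sub_eq_add_neg] at this
        exact this.rotate.rotate
      · intro h
        have := sub_ne_add 0 hps
        apply this
        rw [zero_sub, zero_add, ← neg_smul, ← MulOpposite.op_neg, ← h]
      · intro t ht
        apply hsr (1 - 2 * t)
        rw [eq_add_of_sub_eq ht, two_mul, coe_sub, coe_add, coe_one, mul_sub, mul_one,
          mul_add, sub_mul, neg_mul]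
        abel
  · rintro rfl
    constructor
    · refine ⟨z + p <• (1 : ℍ[ℝ]), ⟨1, by simp, rfl⟩, z + p <• qi,
        ⟨_, normSq_qi, rfl⟩, ?_, ?_⟩
      · intro h
        have := congrArg (fun z : ℍ[ℝ] => z.re) (smul_left_cancel hp (add_left_cancel h))
        simp at this
      · have := cosph_of_not_collinear z hp (a := 0) (b := 1) (c := qi) (by simp) ?_
        · simpa using this
        · intro t ht
          have := congrArg (fun z : ℍ[ℝ] => z.imI) ht
          simp at this
    · rintro x y h hc
      obtain ⟨q, hq, rfl, hS⟩ := exists_of_mem_sph hp h.1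
      rw [← hS] at h
      rw [antipodal_iff hq] at h
      subst h
      have h1 : z = z + q + (z - q - (z + q)) <• (((1 / 2 : ℝ)) : ℍ[ℝ]) := by
        have h2 : q <• (((1 / 2 : ℝ)) : ℍ[ℝ]) + q <• (((1 / 2 : ℝ)) : ℍ[ℝ]) = q := by
          rw [← add_smul, ← MulOpposite.op_add, ← coe_add]
          norm_num
        rw [show z - q - (z + q) = -(q + q) by abel, smul_neg, smul_add, h2]
        abel
      have hc' : Cosph (z + q) (z - q)
          (z + q + (z - q - (z + q)) <• (((1 / 2 : ℝ)) : ℍ[ℝ])) := h1 ▸ hc.rotate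
      rcases eq_zero_or_one_of_cosph (sub_ne_add z hq).symm hc' with h | h <;> norm_num at h

/-! ### Additivity of bijections preserving spheres. -/

/-- The map `F` sends spheres in quaternionic lines to spheres in quaternionic lines. -/
def PreservesSpheres (F : W m → W m) : Prop :=
  ∀ ζ u : W m, u ≠ 0 → ∃ ζ' u' : W m, u' ≠ 0 ∧ F '' sph ζ u = sph ζ' u'

theorem PreservesSpheres.cosph {F : W m → W m} (hF : PreservesSpheres F) {x y z : W m}
    (h : Cosph x y z) : Cosph (F x) (F y) (F z) := by
  obtain ⟨ζ, u, hu, h1, h2, h3⟩ := h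
  obtain ⟨ζ', u', hu', h'⟩ := hF ζ u hu
  refine ⟨ζ', u', hu', ?_⟩
  rw [← h']
  exact ⟨Set.mem_image_of_mem F h1, Set.mem_image_of_mem F h2, Set.mem_image_of_mem F h3⟩

section Incidence

variable {F : W m ≃ W m}

theorem cosph_map_iff (hF : PreservesSpheres F) (hF' : PreservesSpheres F.symm) {x y z : W m} :
    Cosph (F x) (F y) (F z) ↔ Cosph x y z :=
  ⟨fun h => by simpa using hF'.cosph h, hF.cosph⟩

theorem tangent_map_iff (hF : PreservesSpheres F) (hF' : PreservesSpheres F.symm) {z x : W m}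
    {S : Set (W m)} : Tangent (F z) (F x) (F '' S) ↔ Tangent z x S := by
  simp only [Tangent, Set.forall_mem_image, cosph_map_iff hF hF', ne_eq, F.injective.eq_iff,
    F.injective.mem_set_image]

theorem antipodal_map_iff (hF : PreservesSpheres F) (hF' : PreservesSpheres F.symm) {x y : W m}
    {S : Set (W m)} : Antipodal (F x) (F y) (F '' S) ↔ Antipodal x y S := by
  simp only [Antipodal, ne_eq, F.injective.eq_iff, F.injective.mem_set_image]
  refine and_congr_right fun _ => and_congr_right fun _ => and_congr_right fun _ =>
    ⟨fun h z => ?_, fun h z => ?_⟩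
  · simpa only [tangent_map_iff hF hF'] using h (F z)
  · obtain ⟨z, rfl⟩ := F.surjective z
    simpa only [tangent_map_iff hF hF'] using h z

theorem center_map_iff (hF : PreservesSpheres F) (hF' : PreservesSpheres F.symm) {z : W m}
    {S : Set (W m)} : Center (F z) (F '' S) ↔ Center z S := by
  simp only [Center, ne_eq, F.injective.eq_iff, Set.exists_mem_image, cosph_map_iff hF hF']
  refine and_congr_right fun _ => ⟨fun h x y hxy hc => ?_, fun h x y hxy hc => ?_⟩
  · exact h (F x) (F y) ((antipodal_map_iff hF hF').2 hxy) ((cosph_map_iff hF hF').2 hc)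
  · obtain ⟨x, rfl⟩ := F.surjective x
    obtain ⟨y, rfl⟩ := F.surjective y
    exact h x y ((antipodal_map_iff hF hF').1 hxy) ((cosph_map_iff hF hF').1 hc)

/-- A bijection preserving spheres in quaternionic lines in both directions preserves their
centres. -/
theorem exists_image_sph (hF : PreservesSpheres F) (hF' : PreservesSpheres F.symm) (ζ : W m)
    {u : W m} (hu : u ≠ 0) : ∃ u', u' ≠ 0 ∧ F '' sph ζ u = sph (F ζ) u' := by
  obtain ⟨ζ', u', hu', h⟩ := hF ζ u hu
  have h1 : Center (F ζ) (F '' sph ζ u) := (center_map_iff hF hF').2 ((center_iff hu).2 rfl)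
  rw [h, center_iff hu'] at h1
  exact ⟨u', hu', by rw [h, h1]⟩

/-- Centres and antipodal pairs are preserved, so `F` maps the midpoint of `ζ + u` and `ζ - u` to
the midpoint of their images. -/
theorem map_add_add_map_sub (hF : PreservesSpheres F) (hF' : PreservesSpheres F.symm) (ζ u : W m) :
    F (ζ + u) + F (ζ - u) = F ζ + F ζ := by
  rcases eq_or_ne u 0 with rfl | hu
  · simp
  obtain ⟨u', hu', h⟩ := exists_image_sph hF hF' ζ hu
  have h1 : Antipodal (F (ζ + u)) (F (ζ - u)) (F '' sph ζ u) :=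
    (antipodal_map_iff hF hF').2 ((antipodal_iff hu).2 rfl)
  obtain ⟨p, hp, h2, h3⟩ := exists_of_mem_sph hu' (h ▸ h1.1)
  rw [h, ← h3, h2, antipodal_iff hp] at h1
  rw [h1, h2]
  abel

/-- A bijection fixing `0` and preserving spheres in quaternionic lines in both directions is
additive. -/
theorem map_add_of_preservesSpheres (hF : PreservesSpheres F) (hF' : PreservesSpheres F.symm)
    (h0 : F 0 = 0) (x y : W m) : F (x + y) = F x + F y := by
  have hdbl : ∀ x, F (x + x) = F x + F x := by
    intro x
    have := map_add_add_map_sub hF hF' x x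
    rwa [sub_self, h0, add_zero] at this
  have half : ∀ x : W m, (2⁻¹ : ℝ) • x + (2⁻¹ : ℝ) • x = x := by
    intro x
    rw [← add_smul]
    norm_num
  set a := (2⁻¹ : ℝ) • x
  set b := (2⁻¹ : ℝ) • y
  -- Here `a + b` is the midpoint of `x` and `y`, and `hdbl` absorbs the factor two.
  have := map_add_add_map_sub hF hF' (a + b) (a - b)
  rw [show a + b + (a - b) = a + a by abel, show a + b - (a - b) = b + b by abel, half, half,
    ← hdbl, show a + b + (a + b) = (a + a) + (b + b) by abel, half, half] at this
  exact this.symm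

end Incidence

/-! ### Block coordinates and Heisenberg coordinates on the boundary. -/

/-- The vector of `ℍ^{m+2}` with first coordinate `a`, middle coordinates `w` and last
coordinate `b`. -/
def vec (a : ℍ[ℝ]) (w : W m) (b : ℍ[ℝ]) : V (m + 1) :=
  Fin.cons a (Fin.snoc w b : Fin (m + 1) → ℍ[ℝ])

/-- The middle coordinates of a vector of `ℍ^{m+2}`. -/
def mid (v : V (m + 1)) : W m := fun i => v i.castSucc.succ

@[simp] theorem vec_zero (a : ℍ[ℝ]) (w : W m) (b : ℍ[ℝ]) : vec a w b 0 = a := rfl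

@[simp] theorem vec_last (a : ℍ[ℝ]) (w : W m) (b : ℍ[ℝ]) : vec a w b (Fin.last (m + 1)) = b := by
  rw [← Fin.succ_last, vec, Fin.cons_succ, Fin.snoc_last]

@[simp] theorem vec_castSucc_succ (a : ℍ[ℝ]) (w : W m) (b : ℍ[ℝ]) (i : Fin m) :
    vec a w b i.castSucc.succ = w i := by
  rw [vec, Fin.cons_succ, Fin.snoc_castSucc]

@[simp] theorem mid_vec (a : ℍ[ℝ]) (w : W m) (b : ℍ[ℝ]) : mid (vec a w b) = w := by
  ext1 i
  simp [mid]

theorem vec_ext {v v' : V (m + 1)} (h0 : v 0 = v' 0) (h1 : mid v = mid v')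
    (h2 : v (Fin.last (m + 1)) = v' (Fin.last (m + 1))) : v = v' := by
  ext1 i
  refine Fin.cases h0 (fun i => ?_) i
  refine Fin.lastCases ?_ (fun i => ?_) i
  · rwa [Fin.succ_last]
  · exact congrFun h1 i

theorem vec_eta (v : V (m + 1)) : vec (v 0) (mid v) (v (Fin.last (m + 1))) = v :=
  vec_ext (by simp) (by simp) (by simp)

theorem mid_add (v v' : V (m + 1)) : mid (v + v') = mid v + mid v' := rfl

theorem mid_smul (v : V (m + 1)) (s : ℍ[ℝ]) : mid (v <• s) = mid v <• s := rfl

theorem vec_add (a a' : ℍ[ℝ]) (w w' : W m) (b b' : ℍ[ℝ]) :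
    vec a w b + vec a' w' b' = vec (a + a') (w + w') (b + b') :=
  vec_ext (by simp) (by simp [mid_add]) (by simp)

theorem vec_smul (a : ℍ[ℝ]) (w : W m) (b s : ℍ[ℝ]) :
    vec a w b <• s = vec (a * s) (w <• s) (b * s) :=
  vec_ext (by simp) (by simp [mid_smul]) (by simp)

theorem vec_inj {a a' : ℍ[ℝ]} {w w' : W m} {b b' : ℍ[ℝ]} :
    vec a w b = vec a' w' b' ↔ a = a' ∧ w = w' ∧ b = b' := by
  constructor
  · intro h
    refine ⟨?_, ?_, ?_⟩
    · simpa using congrFun h 0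
    · simpa using congrArg mid h
    · simpa using congrFun h (Fin.last (m + 1))
  · rintro ⟨rfl, rfl, rfl⟩
    rfl

theorem vec_zero_zero_zero : vec 0 (0 : W m) 0 = 0 :=
  vec_ext (by simp) (by rw [mid_vec]; rfl) (by simp)

theorem vec_eq_zero {a : ℍ[ℝ]} {w : W m} {b : ℍ[ℝ]} :
    vec a w b = 0 ↔ a = 0 ∧ w = 0 ∧ b = 0 := by
  rw [← vec_zero_zero_zero, vec_inj]

theorem q_eq (v : V (m + 1)) :
    q v = nsq (mid v) - 2 * (star (v 0) * v (Fin.last (m + 1))).re := by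
  have : Finset.Ioo 0 (Fin.last (m + 1)) =
      Finset.univ.map ((Fin.castSuccEmb (n := m)).trans (Fin.succEmb (m + 1))) := by
    ext i
    simp only [Finset.mem_Ioo, Finset.mem_map, Finset.mem_univ, true_and]
    constructor
    · rintro ⟨h0, h1⟩
      refine ⟨⟨i.1 - 1, ?_⟩, ?_⟩
      · rw [Fin.lt_def] at h0 h1
        simp at h0 h1
        omega
      · ext
        rw [Fin.lt_def] at h0
        simp at h0 ⊢
        omega
    · rintro ⟨j, rfl⟩
      simp [Fin.lt_def]
  rw [q, this, Finset.sum_map, tr, nsq]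
  simp only [mid, Function.Embedding.trans_apply, Fin.coe_castSuccEmb, Fin.coe_succEmb]
  ring

theorem q_vec (a : ℍ[ℝ]) (w : W m) (b : ℍ[ℝ]) : q (vec a w b) = nsq w - 2 * (star a * b).re := by
  simp [q_eq]

/-- Isotropic lifts of the boundary points different from `inf`. -/
noncomputable def ptVec (w : W m) (v : ℍ[ℝ]) : V (m + 1) := vec ((nsq w / 2 : ℝ) + v.im) w 1

theorem ptVec_ne_zero (w : W m) (v : ℍ[ℝ]) : ptVec w v ≠ 0 := by
  simp [ptVec, vec_eq_zero]

theorem infVec_ne_zero : vec 1 (0 : W m) 0 ≠ 0 := by simp [vec_eq_zero]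

theorem q_ptVec (w : W m) (v : ℍ[ℝ]) : q (ptVec w v) = 0 := by
  rw [ptVec, q_vec, mul_one, re_star, re_add, re_coe, re_im]
  ring

/-- The boundary point `[1 : 0 : 0]`. -/
noncomputable def inf : boundary (m + 1) :=
  ⟨Projectivization.mk _ (vec 1 0 0) infVec_ne_zero, by simp [mk_mem_boundary, q_vec]⟩

/-- The boundary point with Heisenberg coordinates `w` and `v.im`. -/
noncomputable def pt (w : W m) (v : ℍ[ℝ]) : boundary (m + 1) :=
  ⟨Projectivization.mk _ (ptVec w v) (ptVec_ne_zero w v), by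
    rw [mk_mem_boundary, q_ptVec]⟩

theorem pt_ne_inf (w : W m) (v : ℍ[ℝ]) : pt w v ≠ inf := by
  intro h
  have := congrArg Subtype.val h
  rw [pt, inf, Projectivization.mk_eq_mk_iff'] at this
  obtain ⟨a, ha⟩ := this
  rw [← MulOpposite.op_unop a, vec_smul, ptVec, vec_inj] at ha
  simp at ha

theorem pt_eq_pt_iff {w w' : W m} {v v' : ℍ[ℝ]} : pt w v = pt w' v' ↔ w = w' ∧ v.im = v'.im := by
  constructor
  · intro h
    have := congrArg Subtype.val h
    rw [pt, pt, Projectivization.mk_eq_mk_iff'] at this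
    obtain ⟨a, ha⟩ := this
    rw [← MulOpposite.op_unop a, ptVec, vec_smul, ptVec, vec_inj, one_mul] at ha
    obtain ⟨h1, h2, h3⟩ := ha
    rw [h3, MulOpposite.op_one, one_smul] at h2
    rw [h3, mul_one, h2, add_right_inj] at h1
    exact ⟨h2.symm, h1.symm⟩
  · rintro ⟨rfl, h⟩
    simp only [pt, ptVec, h]

theorem pt_im (w : W m) (v : ℍ[ℝ]) : pt w v.im = pt w v := by
  simp [pt_eq_pt_iff]

/-- For an isotropic vector, last coordinate zero forces the middle part to vanish. Otherwise the
last coordinate is scaled to `1`, and `q = 0` fixes the real part of the first. -/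
theorem eq_inf_or_eq_pt (x : boundary (m + 1)) : x = inf ∨ ∃ w v, x = pt w v := by
  obtain ⟨x, hx⟩ := x
  induction x using Projectivization.ind with | h v hv
  rw [mk_mem_boundary] at hx
  by_cases hl : v (Fin.last (m + 1)) = 0
  · left
    rw [q_eq, hl, mul_zero, re_zero, mul_zero, sub_zero, nsq_eq_zero] at hx
    refine Subtype.ext ?_
    rw [inf, Projectivization.mk_eq_mk_iff']
    refine ⟨MulOpposite.op (v 0), ?_⟩
    rw [vec_smul]
    exact vec_ext (by simp) (by simp [hx]) (by simp [hl])
  · right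
    set b := v (Fin.last (m + 1)) with hb
    have hq : q (v <• b⁻¹) = 0 := by rw [q_smul, hx, mul_zero]
    have hl' : (v <• b⁻¹) (Fin.last (m + 1)) = 1 := by
      simp [← hb, hl]
    rw [q_eq, hl', mul_one, re_star] at hq
    refine ⟨mid (v <• b⁻¹), (v <• b⁻¹) 0, Subtype.ext ?_⟩
    rw [pt, eq_comm, Projectivization.mk_eq_mk_iff']
    refine ⟨MulOpposite.op b⁻¹, vec_ext ?_ ?_ ?_⟩
    · rw [ptVec, vec_zero, ← re_add_im ((v <• b⁻¹) 0)]
      have : ((v <• b⁻¹) 0).re = nsq (mid (v <• b⁻¹)) / 2 := by linarith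
      rw [this, im_add, im_coe, im_idem, zero_add]
    · rw [ptVec, mid_vec]
    · rw [ptVec, vec_last, hl']

/-! ### Chains and two-dimensional subspaces. -/

theorem mk_mem_points {n : ℕ} {L : Submodule (ℍ[ℝ])ᵐᵒᵖ (V n)} {v : V n} {hv : v ≠ 0} :
    Projectivization.mk (ℍ[ℝ])ᵐᵒᵖ v hv ∈ points L ↔ v ∈ L := by
  simp [points, Projectivization.submodule_mk]

instance : Module.Finite (ℍ[ℝ])ᵐᵒᵖ ℍ[ℝ] :=
  Module.Finite.of_surjective (LinearMap.toSpanSingleton (ℍ[ℝ])ᵐᵒᵖ ℍ[ℝ] 1)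
    fun x => ⟨MulOpposite.op x, by simp⟩

/-- Distinct points have independent lifts, which already span the plane of any chain through both.
-/
theorem IsChain.eq_of_mem {n : ℕ} {C C' : Set (boundary n)} (hC : IsChain C) (hC' : IsChain C')
    {x y : boundary n} (hxy : x ≠ y) (hx : x ∈ C) (hy : y ∈ C) (hx' : x ∈ C') (hy' : y ∈ C') :
    C = C' := by
  obtain ⟨L, hL, -, rfl⟩ := hC
  obtain ⟨L', hL', -, rfl⟩ := hC'
  have hli : LinearIndependent (ℍ[ℝ])ᵐᵒᵖ ![x.1.rep, y.1.rep] := by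
    rw [Projectivization.linearIndependent_pair_iff_ne]
    exact fun h => hxy (Subtype.ext h)
  have hf := finrank_span_eq_card hli
  have key : ∀ M : Submodule (ℍ[ℝ])ᵐᵒᵖ (V n), Module.finrank (ℍ[ℝ])ᵐᵒᵖ M = 1 + 1 →
      (x : P n) ∈ points M → (y : P n) ∈ points M →
      Submodule.span (ℍ[ℝ])ᵐᵒᵖ (Set.range ![x.1.rep, y.1.rep]) = M := by
    intro M hM h1 h2
    rw [points, Set.mem_ofPred_eq, Projectivization.submodule_eq,
      Submodule.span_singleton_le_iff_mem] at h1 h2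
    apply Submodule.eq_of_le_of_finrank_eq
    · rw [Submodule.span_le]
      rintro _ ⟨i, rfl⟩
      fin_cases i
      · exact h1
      · exact h2
    · rw [hf, hM, Fintype.card_fin]
  rw [← key L hL hx hy, ← key L' hL' hx' hy']

theorem linearIndependent_pair {P Q : V (m + 1)} (hP : P ≠ 0) (hP0 : P (Fin.last (m + 1)) = 0)
    (hQ : Q (Fin.last (m + 1)) = 1) : LinearIndependent (ℍ[ℝ])ᵐᵒᵖ ![P, Q] := by
  rw [LinearIndependent.pair_iff]
  intro s t hst
  have ht : t = 0 := by
    have := congrFun hst (Fin.last (m + 1))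
    simpa [hP0, hQ] using this
  rw [ht, zero_smul, add_zero, smul_eq_zero] at hst
  exact ⟨hst.resolve_right hP, ht⟩

theorem finrank_span_pair {P Q : V (m + 1)} (hP : P ≠ 0) (hP0 : P (Fin.last (m + 1)) = 0)
    (hQ : Q (Fin.last (m + 1)) = 1) :
    Module.finrank (ℍ[ℝ])ᵐᵒᵖ (Submodule.span (ℍ[ℝ])ᵐᵒᵖ {P, Q}) = 1 + 1 := by
  have := finrank_span_eq_card (linearIndependent_pair hP hP0 hQ)
  rwa [Matrix.range_cons_cons_empty, Fintype.card_fin] at this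

theorem isChain_span {P Q : V (m + 1)} (hP : P ≠ 0) (hP0 : P (Fin.last (m + 1)) = 0)
    (hQ : Q (Fin.last (m + 1)) = 1) {a : ℍ[ℝ]} (hq : q (P <• a + Q) < 0) :
    IsChain {x : boundary (m + 1) | (x : QuatHyp.P (m + 1)) ∈
      points (Submodule.span (ℍ[ℝ])ᵐᵒᵖ {P, Q})} := by
  have hne : P <• a + Q ≠ 0 := by
    intro h
    have := congrFun h (Fin.last (m + 1))
    simp [hP0, hQ] at this
  refine ⟨_, finrank_span_pair hP hP0 hQ, ⟨Projectivization.mk _ _ hne, ?_, ?_⟩, rfl⟩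
  · rw [mk_mem_points, Submodule.mem_span_pair]
    exact ⟨MulOpposite.op a, 1, by rw [one_smul]⟩
  · rwa [mk_mem_hyperbolicSpace]

/-- A negative vector has non-zero last coordinate; it is scaled to give `Q`, which then clears the
last coordinate of a second basis vector. -/
theorem IsChain.exists_span {C : Set (boundary (m + 1))} (hC : IsChain C) :
    ∃ P Q : V (m + 1), P ≠ 0 ∧ P (Fin.last (m + 1)) = 0 ∧ Q (Fin.last (m + 1)) = 1 ∧
      (∃ a : ℍ[ℝ], q (P <• a + Q) < 0) ∧ C = {x : boundary (m + 1) | (x : QuatHyp.P (m + 1)) ∈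
      points (Submodule.span (ℍ[ℝ])ᵐᵒᵖ {P, Q})} := by
  obtain ⟨L, hL, ⟨x, hxL, hx⟩, rfl⟩ := hC
  induction x using Projectivization.ind with | h R hR
  rw [mk_mem_hyperbolicSpace] at hx
  rw [mk_mem_points] at hxL
  have hl : R (Fin.last (m + 1)) ≠ 0 := by
    intro h
    rw [q_eq, h, mul_zero, re_zero, mul_zero, sub_zero] at hx
    exact absurd hx (nsq_nonneg _).not_gt
  set b := R (Fin.last (m + 1)) with hb
  have hQL : R <• b⁻¹ ∈ L := L.smul_mem _ hxL
  have hQ1 : (R <• b⁻¹) (Fin.last (m + 1)) = 1 := by simp [← hb, hl]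
  have hQq : q (R <• b⁻¹) < 0 := by
    rw [q_smul]
    refine mul_neg_of_pos_of_neg (normSq_nonneg.lt_of_ne ?_) hx
    rw [ne_comm, normSq_ne_zero, MulOpposite.unop_op]
    exact inv_ne_zero hl
  generalize R <• b⁻¹ = Q at hQL hQ1 hQq
  have hQ0 : Q ≠ 0 := by rintro rfl; simp at hQ1
  obtain ⟨S, hSL, hS⟩ : ∃ S ∈ L, S ∉ Submodule.span (ℍ[ℝ])ᵐᵒᵖ {Q} := by
    by_contra! h
    have := Submodule.finrank_mono (show L ≤ Submodule.span (ℍ[ℝ])ᵐᵒᵖ {Q} from h)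
    rw [hL, finrank_span_singleton hQ0] at this
    omega
  have hP : S - Q <• S (Fin.last (m + 1)) ≠ 0 := by
    intro h
    apply hS
    rw [sub_eq_zero.1 h]
    exact Submodule.smul_mem _ _ (Submodule.mem_span_singleton_self Q)
  have hP0 : (S - Q <• S (Fin.last (m + 1))) (Fin.last (m + 1)) = 0 := by simp [hQ1]
  have hPL : S - Q <• S (Fin.last (m + 1)) ∈ L := L.sub_mem hSL (L.smul_mem _ hQL)
  generalize S - Q <• S (Fin.last (m + 1)) = P at hP hP0 hPL
  have hq : q (P <• (0 : ℍ[ℝ]) + Q) < 0 := by simpa using hQq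
  refine ⟨P, Q, hP, hP0, hQ1, ⟨0, hq⟩, ?_⟩
  have hle : Submodule.span (ℍ[ℝ])ᵐᵒᵖ {P, Q} ≤ L := by
    rw [Submodule.span_le]
    rintro _ (rfl | rfl)
    · exact hPL
    · exact hQL
  rw [Submodule.eq_of_le_of_finrank_eq hle]
  rw [hL, finrank_span_pair hP hP0 hQ1]

/-! ### Vertical chains and chains over spheres. -/

/-- The chain through `inf` whose finite points lie above `w`. -/
def vchain (w : W m) : Set (boundary (m + 1)) := {x | x = inf ∨ ∃ v, x = pt w v}

/-- The chain which projects to the sphere with centre `ζ` through `ζ + u`. -/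
def fchain (ζ u : W m) (τ : ℍ[ℝ]) : Set (boundary (m + 1)) :=
  {x | ∃ s : ℍ[ℝ], normSq s = 1 ∧ x = pt (ζ + u <• s) (τ + herm ζ (u <• s))}

theorem span_eq_vchain (w : W m) (a c : ℍ[ℝ]) (ha : a ≠ 0) :
    {x : boundary (m + 1) | (x : P (m + 1)) ∈
      points (Submodule.span (ℍ[ℝ])ᵐᵒᵖ {vec a 0 0, vec c w 1})} = vchain w := by
  ext x
  rw [Set.mem_ofPred_eq]
  rcases eq_inf_or_eq_pt x with rfl | ⟨w', v, rfl⟩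
  · simp only [vchain, Set.mem_ofPred_eq, true_or, iff_true, inf, mk_mem_points,
      Submodule.mem_span_pair]
    refine ⟨MulOpposite.op a⁻¹, 0, ?_⟩
    rw [vec_smul, zero_smul, add_zero, mul_inv_cancel₀ ha]
    simp
  · rw [pt, mk_mem_points, Submodule.mem_span_pair]
    change _ ↔ pt w' v = inf ∨ ∃ v', pt w' v = _
    simp only [pt_ne_inf, false_or, pt_eq_pt_iff]
    constructor
    · rintro ⟨s, t, h⟩
      rw [← MulOpposite.op_unop s, ← MulOpposite.op_unop t, vec_smul, vec_smul, vec_add, ptVec,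
        vec_inj] at h
      obtain ⟨-, h1, h2⟩ := h
      rw [zero_mul, zero_add, one_mul] at h2
      rw [h2, smul_zero, zero_add, MulOpposite.op_one, one_smul] at h1
      exact ⟨v, h1.symm, rfl⟩
    · rintro ⟨v', rfl, hv⟩
      refine ⟨MulOpposite.op (a⁻¹ * ((nsq w' / 2 : ℝ) + v.im - c)), 1, ?_⟩
      rw [vec_smul, one_smul, vec_add, ptVec, mul_inv_cancel_left₀ ha]
      simp

/-- The two spanning vectors are orthogonal, the first has `q = nsq u`, and `hc` gives the second `q
= -nsq u`. Their combination with coefficients `s` and `1` is therefore isotropic exactly when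
`normSq s = 1`. -/
theorem span_eq_fchain (ζ u : W m) (hu : u ≠ 0) (c : ℍ[ℝ]) (hc : 2 * c.re = nsq u + nsq ζ) :
    {x : boundary (m + 1) | (x : P (m + 1)) ∈
      points (Submodule.span (ℍ[ℝ])ᵐᵒᵖ {vec (herm ζ u) u 0, vec c ζ 1})} = fchain ζ u c := by
  ext x
  rw [Set.mem_ofPred_eq]
  rcases eq_inf_or_eq_pt x with rfl | ⟨w, v, rfl⟩
  · refine iff_of_false ?_ fun ⟨s, _, h⟩ => pt_ne_inf _ _ h.symm
    rw [inf, mk_mem_points, Submodule.mem_span_pair]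
    rintro ⟨s, t, h⟩
    rw [← MulOpposite.op_unop s, ← MulOpposite.op_unop t, vec_smul, vec_smul, vec_add,
      vec_inj] at h
    obtain ⟨h0, h1, h2⟩ := h
    rw [zero_mul, zero_add, one_mul] at h2
    rw [h2, MulOpposite.op_zero, zero_smul, add_zero] at h1
    by_cases hs : MulOpposite.unop s = 0
    · simp [hs, h2] at h0
    · exact smul_ne_zero_of hu hs h1
  · rw [pt, mk_mem_points, Submodule.mem_span_pair]
    change _ ↔ ∃ s : ℍ[ℝ], normSq s = 1 ∧ pt w v = _
    simp only [pt_eq_pt_iff]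
    constructor
    · rintro ⟨s, t, h⟩
      rw [← MulOpposite.op_unop s, ← MulOpposite.op_unop t, vec_smul, vec_smul, vec_add, ptVec,
        vec_inj] at h
      obtain ⟨h0, h1, h2⟩ := h
      rw [zero_mul, zero_add, one_mul] at h2
      rw [h2, MulOpposite.op_one, one_smul, add_comm] at h1
      rw [h2, mul_one, ← herm_smul_right] at h0
      refine ⟨_, ?_, h1.symm, ?_⟩
      · have h3 := congrArg (fun z : ℍ[ℝ] => z.re) h0
        simp only [re_add, re_coe, re_im, ← h1, nsq_add, nsq_smul] at h3
        have h4 : nsq u * (normSq (MulOpposite.unop s) - 1) = 0 := by linarith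
        have := (mul_eq_zero.1 h4).resolve_left (nsq_pos hu).ne'
        linarith
      · have h3 := congrArg (fun z : ℍ[ℝ] => z.im) h0
        simp only [im_add, im_coe, im_idem, zero_add] at h3
        rw [← h3, im_add, add_comm]
    · rintro ⟨s, hs, rfl, hv⟩
      refine ⟨MulOpposite.op s, 1, ?_⟩
      rw [vec_smul, one_smul, vec_add, ptVec, vec_inj, zero_mul, zero_add, add_comm (u <• s),
        ← herm_smul_right]
      refine ⟨?_, rfl, rfl⟩
      rw [hv, ← re_add_im (herm ζ (u <• s) + c), nsq_add, nsq_smul, hs, im_add, im_add, re_add,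
        add_comm c.im]
      congr 2
      linarith

theorem isChain_vchain (w : W m) : IsChain (vchain w) := by
  rw [← span_eq_vchain w 1 (nsq w : ℝ) one_ne_zero]
  have : q (vec 1 (0 : W m) 0 <• (1 : ℍ[ℝ]) + vec (nsq w : ℝ) w 1) < 0 := by
    rw [vec_smul, vec_add, q_vec]
    simp
    linarith [nsq_nonneg w]
  exact isChain_span infVec_ne_zero (by simp) (by simp) this

theorem fchain_im (ζ u : W m) (τ : ℍ[ℝ]) : fchain ζ u τ.im = fchain ζ u τ := by
  ext x
  simp only [fchain, Set.mem_ofPred_eq]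
  refine exists_congr fun s => and_congr_right fun _ => ?_
  rw [show pt (ζ + u <• s) (τ.im + herm ζ (u <• s)) = pt (ζ + u <• s) (τ + herm ζ (u <• s)) by
    simp [pt_eq_pt_iff]]

theorem isChain_fchain (ζ : W m) {u : W m} (hu : u ≠ 0) (τ : ℍ[ℝ]) : IsChain (fchain ζ u τ) := by
  set c : ℍ[ℝ] := ((nsq u + nsq ζ) / 2 : ℝ) + τ.im with hc
  have hre : c.re = (nsq u + nsq ζ) / 2 := by rw [hc, re_add, re_coe, re_im, add_zero]
  have him : c.im = τ.im := by rw [hc, im_add, im_coe, im_idem, zero_add]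
  rw [← fchain_im, ← him, fchain_im, ← span_eq_fchain ζ u hu c (by rw [hre]; ring)]
  refine isChain_span (a := 0) (by simp [vec_eq_zero, hu]) (by simp) (by simp) ?_
  rw [MulOpposite.op_zero, zero_smul, zero_add, q_vec, mul_one, re_star, hre]
  linarith [nsq_pos hu]

theorem span_pair_smul_add {n : ℕ} (P Q : V n) {r : ℍ[ℝ]} (hr : r ≠ 0) (t : ℍ[ℝ]) :
    Submodule.span (ℍ[ℝ])ᵐᵒᵖ {P <• r, Q + P <• t} = Submodule.span (ℍ[ℝ])ᵐᵒᵖ {P, Q} := by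
  apply le_antisymm <;> rw [Submodule.span_le]
  · have hP := Submodule.subset_span (R := (ℍ[ℝ])ᵐᵒᵖ) (Set.mem_insert P {Q})
    rintro _ (rfl | rfl)
    · exact Submodule.smul_mem _ _ hP
    · exact Submodule.add_mem _ (Submodule.subset_span (by simp)) (Submodule.smul_mem _ _ hP)
  · have hP : P ∈ Submodule.span (ℍ[ℝ])ᵐᵒᵖ {P <• r, Q + P <• t} := by
      have := Submodule.smul_mem _ (MulOpposite.op r⁻¹) (Submodule.subset_span (R := (ℍ[ℝ])ᵐᵒᵖ)
        (Set.mem_insert (P <• r) {Q + P <• t}))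
      rwa [op_smul_op_smul, mul_inv_cancel₀ hr, MulOpposite.op_one, one_smul] at this
    rintro x (hx | hx)
    · rwa [hx]
    · rw [show x = Q from hx]
      have := Submodule.sub_mem _ (Submodule.subset_span (R := (ℍ[ℝ])ᵐᵒᵖ) (show
        Q + P <• t ∈ {P <• r, Q + P <• t} by simp)) (Submodule.smul_mem _ (MulOpposite.op t) hP)
      rwa [add_sub_cancel_right] at this

theorem IsChain.eq_vchain_or_eq_fchain {C : Set (boundary (m + 1))} (hC : IsChain C) :
    (∃ w, C = vchain w) ∨ ∃ ζ u τ, u ≠ 0 ∧ C = fchain ζ u τ := by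
  obtain ⟨P, Q, hP, hP0, hQ, ⟨a, ha⟩, rfl⟩ := hC.exists_span
  rw [← vec_eta P, ← vec_eta Q, hP0, hQ] at ha ⊢
  have hP' : vec (P 0) (mid P) 0 ≠ 0 := by rwa [← hP0, vec_eta]
  generalize P 0 = p at ha hP'
  generalize mid P = w at ha hP'
  generalize Q 0 = c at ha
  generalize mid Q = z at ha
  rcases eq_or_ne w 0 with rfl | hw
  · refine Or.inl ⟨z, span_eq_vchain z p c ?_⟩
    rintro rfl
    exact hP' vec_zero_zero_zero
  · right
    -- Gram–Schmidt: this `t` makes `Q + P <• t` orthogonal to `P`.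
    obtain ⟨t, ht⟩ : ∃ t : ℍ[ℝ], herm (z + w <• t) w = p := by
      refine ⟨star ((p - herm z w) * (((nsq w)⁻¹ : ℝ) : ℍ[ℝ])), ?_⟩
      rw [herm_add_left, herm_smul_left, star_star, herm_self, mul_assoc, ← coe_mul,
        inv_mul_cancel₀ (nsq_pos hw).ne', coe_one, mul_one, add_sub_cancel]
    set ζ := z + w <• t with hζ
    set c' := c + p * t with hc'
    have hpos : 0 < 2 * c'.re - nsq ζ := by
      have h1 : vec p w 0 <• a + vec c z 1 = vec (c' + p * (a - t)) (ζ + w <• (a - t)) 1 := by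
        rw [vec_smul, vec_add, vec_inj, hζ, hc', MulOpposite.op_sub, sub_smul]
        refine ⟨by noncomm_ring, by abel, by simp⟩
      rw [h1, q_vec, mul_one, re_star, re_add, nsq_add, ← ht, ← herm_smul_right] at ha
      linarith [nsq_nonneg (w <• (a - t))]
    -- Rescales `P` so that its `q` is opposite to that of `Q + P <• t`, as `span_eq_fchain`
    -- requires.
    set r := √((2 * c'.re - nsq ζ) / nsq w) with hr
    have hr0 : 0 < r := Real.sqrt_pos.2 (div_pos hpos (nsq_pos hw))
    have hr0' : (r : ℍ[ℝ]) ≠ 0 := by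
      rw [← coe_zero, ne_eq, coe_inj]
      exact hr0.ne'
    have hr2 : nsq w * r ^ 2 = 2 * c'.re - nsq ζ := by
      rw [hr, Real.sq_sqrt (div_pos hpos (nsq_pos hw)).le, mul_div_cancel₀ _ (nsq_pos hw).ne']
    refine ⟨ζ, w <• (r : ℍ[ℝ]), c', smul_ne_zero_of hw hr0', ?_⟩
    rw [← span_eq_fchain ζ _ (smul_ne_zero_of hw hr0'), ← span_pair_smul_add _ _ hr0' t, vec_smul,
      vec_smul, vec_add, herm_smul_right, ht]
    · simp [hζ, hc']
    · rw [nsq_smul, normSq_coe, hr2]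
      ring

theorem pt_mem_fchain {ζ u w : W m} {s v τ : ℍ[ℝ]} (hs : normSq s = 1) (hw : w = ζ + u <• s)
    (hv : v.im = (τ + herm ζ (u <• s)).im) : pt w v ∈ fchain ζ u τ :=
  ⟨s, hs, pt_eq_pt_iff.2 ⟨hw, hv⟩⟩

theorem inf_notMem_fchain (ζ u : W m) (τ : ℍ[ℝ]) : inf ∉ fchain ζ u τ :=
  fun ⟨_, _, h⟩ => pt_ne_inf _ _ h.symm

theorem exists_of_pt_mem_fchain {ζ u w : W m} {v τ : ℍ[ℝ]} (h : pt w v ∈ fchain ζ u τ) :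
    w ∈ sph ζ u ∧ v.im = (τ + herm ζ (w - ζ)).im := by
  obtain ⟨s, hs, h⟩ := h
  obtain ⟨rfl, hv⟩ := pt_eq_pt_iff.1 h
  exact ⟨⟨s, hs, rfl⟩, by rw [hv, add_sub_cancel_left]⟩

theorem inf_mem_vchain (w : W m) : inf ∈ vchain w := Or.inl rfl

theorem pt_mem_vchain_iff {w w' : W m} {v : ℍ[ℝ]} : pt w' v ∈ vchain w ↔ w' = w := by
  constructor
  · rintro (h | ⟨v', h⟩)
    · exact absurd h (pt_ne_inf _ _)
    · exact (pt_eq_pt_iff.1 h).1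
  · rintro rfl
    exact Or.inr ⟨v, rfl⟩

theorem IsChain.exists_ne {C : Set (boundary (m + 1))} (hC : IsChain C) :
    ∃ x ∈ C, ∃ y ∈ C, x ≠ y := by
  rcases hC.eq_vchain_or_eq_fchain with ⟨w, rfl⟩ | ⟨ζ, u, τ, hu, rfl⟩
  · exact ⟨_, pt_mem_vchain_iff.2 rfl, inf, inf_mem_vchain w, pt_ne_inf w 0⟩
  · refine ⟨_, ⟨1, by simp, rfl⟩, _, ⟨-1, by simp, rfl⟩, fun h => ?_⟩
    have := smul_left_cancel hu (add_left_cancel (pt_eq_pt_iff.1 h).1)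
    have := congrArg (fun z : ℍ[ℝ] => z.re) this
    norm_num at this

/-! ### Existence of a chain through two points. -/

/-- The points `pt w v` and `pt w' v'` lie on a common chain with centre `ζ`. -/
theorem mem_fchain_pair {ζ u w w' : W m} {s v v' : ℍ[ℝ]} (hs : normSq s = 1) (hw : w = ζ + u)
    (hw' : w' = ζ + u <• s) (hv : (v - v').im = (herm ζ (w - w')).im) :
    pt w v ∈ fchain ζ u (v - herm ζ u) ∧ pt w' v' ∈ fchain ζ u (v - herm ζ u) := by
  refine ⟨pt_mem_fchain (s := 1) (by simp) (by simp [hw]) (by simp), pt_mem_fchain hs hw' ?_⟩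
  rw [hw, hw', add_sub_add_left_eq_sub, herm_sub_right, im_sub, im_sub] at hv
  rw [im_add, im_sub]
  rw [sub_eq_sub_iff_sub_eq_sub, sub_eq_iff_eq_add] at hv
  rw [hv]
  abel

theorem one_sub_ne_zero {r : ℍ[ℝ]} (hr : r.re = 0) : 1 - r ≠ 0 := by
  intro h
  have := congrArg (fun z : ℍ[ℝ] => z.re) h
  simp [hr] at this

theorem normSq_cayley {r : ℍ[ℝ]} (hr : r.re = 0) : normSq (-((1 - r)⁻¹ * (1 + r))) = 1 := by
  have h : normSq (1 + r) = normSq (1 - r) := by simp [normSq_def', hr]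
  rw [normSq_neg, map_mul, map_inv₀, h,
    inv_mul_cancel₀ (normSq_ne_zero.2 (one_sub_ne_zero hr))]

/-- Write `w - w' = d + d`. For imaginary `r`, the centre `w' + d + d <• r` is equidistant from `w`
and `w'`, a Cayley transform being the unit quaternion between the two radii. Varying `r` changes
the height difference by `-(2 * nsq d) • r`, so it can be adjusted to the given heights. -/
theorem exists_isChain {x y : boundary (m + 1)} (hxy : x ≠ y) :
    ∃ C, IsChain C ∧ x ∈ C ∧ y ∈ C := by
  rcases eq_inf_or_eq_pt x with rfl | ⟨w, v, rfl⟩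
  · rcases eq_inf_or_eq_pt y with rfl | ⟨w, v, rfl⟩
    · exact absurd rfl hxy
    · exact ⟨_, isChain_vchain w, inf_mem_vchain w, pt_mem_vchain_iff.2 rfl⟩
  · rcases eq_inf_or_eq_pt y with rfl | ⟨w', v', rfl⟩
    · exact ⟨_, isChain_vchain w, pt_mem_vchain_iff.2 rfl, inf_mem_vchain w⟩
    · by_cases hw : w = w'
      · exact ⟨_, isChain_vchain w, pt_mem_vchain_iff.2 rfl, pt_mem_vchain_iff.2 hw.symm⟩
      · obtain ⟨d, hd⟩ : ∃ d : W m, w - w' = d + d := by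
          refine ⟨(2⁻¹ : ℝ) • (w - w'), ?_⟩
          rw [← add_smul]
          norm_num
        have hd0 : d ≠ 0 := by
          rintro rfl
          exact hw (sub_eq_zero.1 (by simpa using hd))
        obtain ⟨r, hr, hr'⟩ : ∃ r : ℍ[ℝ], r.re = 0 ∧
            (v - v').im = (herm (w' + d) (d + d)).im - (2 * nsq d) • r := by
          refine ⟨(2 * nsq d)⁻¹ • ((herm (w' + d) (d + d)).im - (v - v').im), ?_, ?_⟩
          · simp
          · rw [smul_inv_smul₀ (mul_ne_zero two_ne_zero (nsq_pos hd0).ne')]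
            abel
        have hne := one_sub_ne_zero hr
        have hstar : star r = -r := by ext <;> simp [hr]
        have h4 : w = w' + d + d <• r + d <• (1 - r) := by
          rw [MulOpposite.op_sub, sub_smul, eq_add_of_sub_eq hd, MulOpposite.op_one, one_smul]
          abel
        have h5 : w' = w' + d + d <• r + (d <• (1 - r)) <• (-((1 - r)⁻¹ * (1 + r))) := by
          rw [op_smul_op_smul, mul_neg, mul_inv_cancel_left₀ hne, MulOpposite.op_neg, neg_smul,
            MulOpposite.op_add, add_smul, MulOpposite.op_one, one_smul]
          abel
        have h6 : (v - v').im = (herm (w' + d + d <• r) (w - w')).im := by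
          have h7 : herm (d <• r) (d + d) = (2 * nsq d) • -r := by
            rw [herm_smul_left, herm_add_right, herm_self, hstar, ← coe_add, mul_coe_eq_smul,
              two_mul]
          rw [hr', hd, herm_add_left (w' + d), im_add, h7, sub_eq_add_neg, ← smul_neg]
          congr 1
          ext <;> simp [hr]
        obtain ⟨h7, h8⟩ := mem_fchain_pair (normSq_cayley hr) h4 h5 h6
        exact ⟨_, isChain_fchain _ (smul_ne_zero_of hd0 hne) _, h7, h8⟩

/-! ### Chain-preserving maps fixing `inf`. -/

/-- A self-map of the boundary mapping chains to chains. -/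
def PreservesChains {n : ℕ} (f : boundary n → boundary n) : Prop :=
  ∀ C : Set (boundary n), IsChain C → IsChain (f '' C)

/-- The chain through the preimages of two points of `C` maps to a chain sharing two points with
`C`, hence to `C` itself. -/
theorem PreservesChains.symm {f : boundary (m + 1) ≃ boundary (m + 1)} (hf : PreservesChains f) :
    PreservesChains f.symm := by
  intro C hC
  obtain ⟨x, hx, y, hy, hxy⟩ := hC.exists_ne
  obtain ⟨D, hD, hxD, hyD⟩ := exists_isChain (f.symm.injective.ne hxy)
  have : f '' D = C := by
    refine (hf D hD).eq_of_mem hC hxy ?_ ?_ hx hy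
    · exact ⟨_, hxD, by simp⟩
    · exact ⟨_, hyD, by simp⟩
  rw [← this, ← Set.image_comp]
  simpa

theorem PreservesChains.exists_image_vchain {f : boundary (m + 1) ≃ boundary (m + 1)}
    (hf : PreservesChains f) (hinf : f inf = inf) (w : W m) :
    ∃ w', f '' vchain w = vchain w' := by
  rcases (hf _ (isChain_vchain w)).eq_vchain_or_eq_fchain with h | ⟨ζ, u, τ, -, h⟩
  · exact h
  · have : inf ∈ f '' vchain w := ⟨inf, inf_mem_vchain w, hinf⟩
    rw [h] at this
    exact absurd this (inf_notMem_fchain _ _ _)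

theorem PreservesChains.exists_coordinates {f : boundary (m + 1) ≃ boundary (m + 1)}
    (hf : PreservesChains f) (hinf : f inf = inf) :
    ∃ (F : W m ≃ W m) (φ φ' : W m → ℍ[ℝ] → ℍ[ℝ]), (∀ w v, f (pt w v) = pt (F w) (φ w v)) ∧
      ∀ w v, f.symm (pt w v) = pt (F.symm w) (φ' w v) := by
  have hinf' : f.symm inf = inf := by rw [f.symm_apply_eq, hinf]
  choose F hF using hf.exists_image_vchain hinf
  choose F' hF' using hf.symm.exists_image_vchain hinf'
  have hinj : ∀ {w w' : W m}, vchain w = vchain w' → w = w' := by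
    intro w w' h
    have : pt w 0 ∈ vchain w' := h ▸ pt_mem_vchain_iff.2 rfl
    exact pt_mem_vchain_iff.1 this
  have h1 : ∀ w, F' (F w) = w := by
    intro w
    apply hinj
    rw [← hF', ← hF, ← Set.image_comp]
    simp
  have h2 : ∀ w, F (F' w) = w := by
    intro w
    apply hinj
    rw [← hF, ← hF', ← Set.image_comp]
    simp
  have key : ∀ (g : boundary (m + 1) ≃ boundary (m + 1)) (G : W m → W m),
      g inf = inf → (∀ w, g '' vchain w = vchain (G w)) → ∀ w v, ∃ v', g (pt w v) = pt (G w) v' := by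
    intro g G hg hG w v
    have : g (pt w v) ∈ vchain (G w) := hG w ▸ ⟨_, pt_mem_vchain_iff.2 rfl, rfl⟩
    rcases this with h | h
    · rw [← hg, g.apply_eq_iff_eq] at h
      exact absurd h (pt_ne_inf _ _)
    · exact h
  choose φ hφ using key f F hinf hF
  choose φ' hφ' using key f.symm F' hinf' hF'
  exact ⟨⟨F, F', h1, h2⟩, φ, φ', hφ, hφ'⟩

section Coordinates

variable {f : boundary (m + 1) ≃ boundary (m + 1)} {F : W m ≃ W m} {φ : W m → ℍ[ℝ] → ℍ[ℝ]}

theorem exists_image_fchain (hf : PreservesChains f) (hinf : f inf = inf)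
    (hφ : ∀ w v, f (pt w v) = pt (F w) (φ w v)) (ζ : W m) {u : W m} (hu : u ≠ 0) (τ : ℍ[ℝ]) :
    ∃ ζ' u' τ', u' ≠ 0 ∧ f '' fchain ζ u τ = fchain ζ' u' τ' ∧ F '' sph ζ u = sph ζ' u' := by
  rcases (hf _ (isChain_fchain ζ hu τ)).eq_vchain_or_eq_fchain with ⟨w, h⟩ | ⟨ζ', u', τ', hu', h⟩
  · obtain ⟨x, hx, hx'⟩ : inf ∈ f '' fchain ζ u τ := h ▸ inf_mem_vchain w
    rw [← hinf, f.apply_eq_iff_eq] at hx'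
    exact absurd (hx' ▸ hx) (inf_notMem_fchain _ _ _)
  · refine ⟨ζ', u', τ', hu', h, ?_⟩
    ext y
    constructor
    · rintro ⟨_, ⟨s, hs, rfl⟩, rfl⟩
      have : f (pt (ζ + u <• s) (τ + herm ζ (u <• s))) ∈ fchain ζ' u' τ' := h ▸ ⟨_, ⟨s, hs, rfl⟩, rfl⟩
      rw [hφ] at this
      exact (exists_of_pt_mem_fchain this).1
    · rintro ⟨s, hs, rfl⟩
      obtain ⟨_, ⟨t, ht, rfl⟩, hx⟩ : pt (ζ' + u' <• s) (τ' + herm ζ' (u' <• s)) ∈ f '' fchain ζ u τ :=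
        h ▸ ⟨s, hs, rfl⟩
      rw [hφ] at hx
      exact ⟨_, ⟨t, ht, rfl⟩, (pt_eq_pt_iff.1 hx).1⟩

theorem preservesSpheres (hf : PreservesChains f) (hinf : f inf = inf)
    (hφ : ∀ w v, f (pt w v) = pt (F w) (φ w v)) : PreservesSpheres F := fun ζ _ hu => by
  obtain ⟨ζ', u', -, hu', -, h⟩ := exists_image_fchain hf hinf hφ ζ hu 0
  exact ⟨ζ', u', hu', h⟩

/-- If `pt w v` and `pt w' v'` lie on a chain with centre `ζ`, then their images lie on a chain
with centre `F ζ`. -/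
theorem im_sub_eq (hf : PreservesChains f) (hinf : f inf = inf)
    (hφ : ∀ w v, f (pt w v) = pt (F w) (φ w v)) (hF : PreservesSpheres F)
    (hF' : PreservesSpheres F.symm) {ζ u w w' : W m} {s v v' : ℍ[ℝ]} (hu : u ≠ 0)
    (hs : normSq s = 1) (hw : w = ζ + u) (hw' : w' = ζ + u <• s)
    (hv : (v - v').im = (herm ζ (w - w')).im) :
    (φ w v - φ w' v').im = (herm (F ζ) (F w - F w')).im := by
  obtain ⟨h1, h2⟩ := mem_fchain_pair hs hw hw' hv
  obtain ⟨ζ', u', τ', hu', h3, h4⟩ := exists_image_fchain hf hinf hφ ζ hu (v - herm ζ u)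
  obtain ⟨u'', hu'', h5⟩ := exists_image_sph hF hF' ζ hu
  have hζ : F ζ = ζ' := (center_iff hu').1 (h4 ▸ h5 ▸ (center_iff hu'').2 rfl)
  have h6 : f (pt w v) ∈ fchain ζ' u' τ' := h3 ▸ ⟨_, h1, rfl⟩
  have h7 : f (pt w' v') ∈ fchain ζ' u' τ' := h3 ▸ ⟨_, h2, rfl⟩
  rw [hφ] at h6 h7
  rw [im_sub, (exists_of_pt_mem_fchain h6).2, (exists_of_pt_mem_fchain h7).2, hζ, ← im_sub,
    add_sub_add_left_eq_sub, ← herm_sub_right, sub_sub_sub_cancel_right]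

end Coordinates

/-! ### How `F` acts on quaternionic scalars. -/

/-- A ring endomorphism of the quaternions fixing the reals is inner. -/
theorem exists_conj (g : ℍ[ℝ] →+* ℍ[ℝ]) (hg : ∀ t : ℝ, g t = t) :
    ∃ a : ℍ[ℝ], normSq a = 1 ∧ ∀ s, g s * a = a * s := by
  have hii : qi * qi = -1 := by ext <;> simp
  have hjj : qj * qj = -1 := by ext <;> simp
  have hij : qi * qj = qk := by ext <;> simp
  have hji : qj * qi = -qk := by ext <;> simp
  have hkk : qk * qk = -1 := by ext <;> simp
  have hki : qk * qi = qj := by ext <;> simp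
  have hik : qi * qk = -qj := by ext <;> simp
  have hjk : qj * qk = qi := by ext <;> simp
  have hkj : qk * qj = -qi := by ext <;> simp
  -- The sum of `g e * x * e⁻¹` over `e = 1, i, j, k`: averaging makes it intertwine `g` with the
  -- identity for every `x`.
  set A : ℍ[ℝ] → ℍ[ℝ] := fun x => x - g qi * x * qi - g qj * x * qj - g qk * x * qk with hA
  have hAi : ∀ x, g qi * A x = A x * qi := by
    intro x
    simp only [hA, mul_sub, sub_mul, ← mul_assoc, ← map_mul, hii, hij, hik]
    simp only [mul_assoc, hii, hji, hki, map_neg, map_one]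
    noncomm_ring
  have hAj : ∀ x, g qj * A x = A x * qj := by
    intro x
    simp only [hA, mul_sub, sub_mul, ← mul_assoc, ← map_mul, hji, hjj, hjk]
    simp only [mul_assoc, hij, hjj, hkj, map_neg, map_one]
    noncomm_ring
  obtain ⟨x, hx⟩ : ∃ x, A x ≠ 0 := by
    by_contra! h
    -- This combination equals `4` whatever `g` is, so `A` cannot vanish identically.
    have h4 : A 1 - A qi * qi - A qj * qj - A qk * qk = (4 : ℕ) • (1 : ℍ[ℝ]) := by
      simp only [hA, mul_one, sub_mul, mul_assoc, hii, hjj, hkk, hij, hji, hki, hik, hjk, hkj,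
        mul_neg, neg_mul, one_mul]
      noncomm_ring
    rw [h, h, h, h, nsmul_eq_mul, mul_one] at h4
    have h5 := congrArg (fun z : ℍ[ℝ] => z.re) h4
    rw [Quaternion.re_natCast] at h5
    simp at h5
  have hn : 0 < normSq (A x) := normSq_nonneg.lt_of_ne (normSq_ne_zero.2 hx).symm
  refine ⟨A x * (((√(normSq (A x)))⁻¹ : ℝ) : ℍ[ℝ]), ?_, fun s => ?_⟩
  · rw [map_mul, normSq_coe, inv_pow, Real.sq_sqrt hn.le, mul_inv_cancel₀ hn.ne']
  · have hs : s = (s.re : ℍ[ℝ]) + (s.imI : ℍ[ℝ]) * qi + (s.imJ : ℍ[ℝ]) * qj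
        + (s.imK : ℍ[ℝ]) * (qi * qj) := by
      ext <;> simp
    have key : g s * A x = A x * s := by
      rw [hs]
      simp only [map_add, map_mul, hg, add_mul, mul_add, mul_assoc, hAi, hAj]
      simp only [← mul_assoc, hAi]
      simp only [mul_assoc, coe_commutes]
    rw [← mul_assoc, key, mul_assoc, mul_assoc, coe_commutes]

variable {F : W m ≃ W m}

theorem exists_map_smul_of_normSq_eq_one (hF : PreservesSpheres F) (hF' : PreservesSpheres F.symm)
    (h0 : F 0 = 0) (w : W m) {s : ℍ[ℝ]} (hs : normSq s = 1) :
    ∃ r : ℍ[ℝ], normSq r = 1 ∧ F (w <• s) = F w <• r := by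
  rcases eq_or_ne w 0 with rfl | hw
  · exact ⟨1, by simp, by rw [smul_zero, h0, smul_zero]⟩
  · obtain ⟨u', hu', h⟩ := exists_image_sph hF hF' 0 hw
    have h1 : F w ∈ sph (F 0) u' := h ▸ ⟨_, ⟨1, by simp, by simp⟩, rfl⟩
    have h2 : F (w <• s) ∈ sph (F 0) u' := h ▸ ⟨_, ⟨s, hs, by simp⟩, rfl⟩
    obtain ⟨p, hp, h3, h4⟩ := exists_of_mem_sph hu' h1
    rw [← h4] at h2
    obtain ⟨r, hr, h5⟩ := h2
    refine ⟨r, hr, ?_⟩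
    rw [h5, h3, h0, zero_add, zero_add]

/-- An additive map of `ℝ` that is bounded near `0` is continuous, hence real-linear. -/
theorem map_coe_smul (hF : PreservesSpheres F) (hF' : PreservesSpheres F.symm)
    (h0 : F 0 = 0) (w : W m) (t : ℝ) : F (w <• (t : ℍ[ℝ])) = F w <• (t : ℍ[ℝ]) := by
  have hadd := map_add_of_preservesSpheres hF hF' h0
  have hcoe : ∀ (x : W m) (t : ℝ), x <• (t : ℍ[ℝ]) = t • x := by
    intro x t
    ext1 i
    simp [mul_coe_eq_smul]
  let G : ℝ →+ W m :=
    { toFun := fun t => F (t • w)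
      map_zero' := by simp [h0]
      map_add' := fun a b => by rw [add_smul, hadd] }
  have hG : Continuous G := by
    refine AddMonoidHom.continuous_of_isBounded_nhds_zero G
      (s := Metric.closedBall 0 1) (Metric.closedBall_mem_nhds 0 one_pos) ?_
    refine (Metric.isBounded_closedBall (x := (0 : W m)) (r := ‖F w‖)).subset ?_
    rintro _ ⟨t, ht, rfl⟩
    rw [mem_closedBall_zero_iff, Real.norm_eq_abs, abs_le] at ht
    rw [mem_closedBall_zero_iff]
    have ht' : 0 ≤ 1 - t ^ 2 := by nlinarith
    -- The unit quaternions `t ± √(1 - t²) i` average to `t`, so `F (t • w)` is the average of two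
    -- unit multiples of `F w`.
    have hs : ∀ e : ℝ, e ^ 2 = 1 → normSq ((t : ℍ[ℝ]) + (e * √(1 - t ^ 2)) • qi) = 1 := by
      intro e he
      simp [normSq_def', mul_pow, he, Real.sq_sqrt ht']
    obtain ⟨r₁, hr₁, h₁⟩ := exists_map_smul_of_normSq_eq_one hF hF' h0 w (hs 1 (by norm_num))
    obtain ⟨r₂, hr₂, h₂⟩ := exists_map_smul_of_normSq_eq_one hF hF' h0 w (hs (-1) (by norm_num))
    have hsum : F (t • w) + F (t • w) = F w <• r₁ + F w <• r₂ := by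
      rw [← h₁, ← h₂, ← hadd, ← hadd, ← add_smul, ← add_smul, ← MulOpposite.op_add]
      congr 1
      rw [← hcoe, coe_add]
      congr 2
      simp only [neg_mul, neg_smul]
      abel
    have hnorm : ∀ r : ℍ[ℝ], normSq r = 1 → ‖F w <• r‖ ≤ ‖F w‖ := by
      intro r hr
      refine (pi_norm_le_iff_of_nonneg (norm_nonneg _)).2 fun i => ?_
      have : ‖r‖ = 1 := by
        rw [normSq_eq_norm_mul_self] at hr
        nlinarith [norm_nonneg r]
      simpa [this] using norm_le_pi_norm (F w) i
    have h3 : ‖F (t • w) + F (t • w)‖ ≤ ‖F w‖ + ‖F w‖ := by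
      rw [hsum]
      exact (norm_add_le _ _).trans (add_le_add (hnorm _ hr₁) (hnorm _ hr₂))
    rw [← two_smul ℝ (F (t • w)), norm_smul] at h3
    norm_num at h3
    change ‖F (t • w)‖ ≤ _
    linarith
  have := map_real_smul G hG t 1
  rw [hcoe, hcoe]
  simpa [G] using this

theorem exists_map_smul (hF : PreservesSpheres F) (hF' : PreservesSpheres F.symm)
    (h0 : F 0 = 0) (w : W m) (s : ℍ[ℝ]) :
    ∃ r : ℍ[ℝ], normSq r = normSq s ∧ F (w <• s) = F w <• r := by
  rcases eq_or_ne s 0 with rfl | hs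
  · exact ⟨0, rfl, by simp [h0]⟩
  have hn : 0 < normSq s := normSq_nonneg.lt_of_ne (normSq_ne_zero.2 hs).symm
  have hn' : √(normSq s) ≠ 0 := (Real.sqrt_pos.2 hn).ne'
  obtain ⟨r, hr, h⟩ := exists_map_smul_of_normSq_eq_one hF hF' h0 w
    (s := s * (((√(normSq s))⁻¹ : ℝ) : ℍ[ℝ])) (by
      rw [map_mul, normSq_coe, inv_pow, Real.sq_sqrt hn.le, mul_inv_cancel₀ hn.ne'])
  refine ⟨r * ((√(normSq s) : ℝ) : ℍ[ℝ]), ?_, ?_⟩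
  · rw [map_mul, normSq_coe, hr, one_mul, Real.sq_sqrt hn.le]
  · rw [← op_smul_op_smul, ← h, ← map_coe_smul hF hF' h0, op_smul_op_smul, mul_assoc, ← coe_mul,
      inv_mul_cancel₀ hn', coe_one, mul_one]

section Coordinates

variable {f : boundary (m + 1) ≃ boundary (m + 1)} {φ : W m → ℍ[ℝ] → ℍ[ℝ]}

/-- The chain centred over the midpoint `d` of `0` and `w` joins points of equal height because
`herm d (d + d)` is real. The same holds for its image, by additivity. -/
theorem im_eq_im_zero (hf : PreservesChains f) (hinf : f inf = inf)
    (hφ : ∀ w v, f (pt w v) = pt (F w) (φ w v)) (hF : PreservesSpheres F)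
    (hF' : PreservesSpheres F.symm) (h0 : F 0 = 0) (w : W m) (v : ℍ[ℝ]) :
    (φ w v).im = (φ 0 v).im := by
  rcases eq_or_ne w 0 with rfl | hw
  · rfl
  have hadd := map_add_of_preservesSpheres hF hF' h0
  obtain ⟨d, rfl⟩ : ∃ d : W m, w = d + d := by
    refine ⟨(2⁻¹ : ℝ) • w, ?_⟩
    rw [← add_smul]
    norm_num
  have hd : d ≠ 0 := by rintro rfl; simp at hw
  have := im_sub_eq hf hinf hφ hF hF' (ζ := d) (u := d) (s := -1) (w := d + d) (w' := 0)
    (v := v) (v' := v) hd (by simp) rfl (by simp) (by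
      rw [sub_zero, herm_add_right, herm_self, ← coe_add, im_coe, sub_self, im_zero])
  rw [h0, sub_zero, hadd, herm_add_right, herm_self, ← coe_add, im_coe, im_sub, sub_eq_zero] at this
  exact this

/-- The action on vertical coordinates determines `F` on quaternionic lines. -/
theorem map_smul_eq (hf : PreservesChains f) (hinf : f inf = inf)
    (hφ : ∀ w v, f (pt w v) = pt (F w) (φ w v)) (hF : PreservesSpheres F)
    (hF' : PreservesSpheres F.symm) (h0 : F 0 = 0) (hφ0 : (φ 0 0).im = 0) {w : W m} (hw : w ≠ 0)
    {t : ℍ[ℝ]} (ht : t.re = 0) {r : ℍ[ℝ]} (hr : F (w <• t) = F w <• r) :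
    (φ 0 t).im = (nsq (F w) / nsq w) • r := by
  have hadd := map_add_of_preservesSpheres hF hF' h0
  have hneg : F (-w) = -F w := by
    rw [eq_neg_iff_add_eq_zero, ← hadd, neg_add_cancel, h0]
  have hw' := (nsq_pos hw).ne'
  have hFw : F w ≠ 0 := by rwa [← h0, F.injective.ne_iff]
  -- `F` preserves the norms of the scalars `t` and `1 + t`, which together determine the real part.
  have hr0 : r.re = 0 := by
    have h1 : ∀ s : ℍ[ℝ], normSq (1 + s) = 1 + normSq s + 2 * s.re := by
      intro s
      rw [normSq_add_re, star_one, one_mul, map_one]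
    obtain ⟨r', hr', h2⟩ := exists_map_smul hF hF' h0 w t
    obtain ⟨r'', hr'', h3⟩ := exists_map_smul hF hF' h0 w (1 + t)
    rw [hr] at h2
    obtain rfl := smul_left_cancel hFw h2
    rw [MulOpposite.op_add, add_smul, hadd, hr, MulOpposite.op_one, one_smul,
      show F w + F w <• r = F w <• (1 + r) by
        rw [MulOpposite.op_add, add_smul, MulOpposite.op_one, one_smul]] at h3
    obtain rfl := smul_left_cancel hFw h3
    rw [h1, h1, hr', ht] at hr''
    linarith
  -- With centre `w <• (t * β)`, the height difference between `w` and `-w` is exactly `t`.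
  set β : ℝ := -(2 * nsq w)⁻¹ with hβ
  have ht' : (t * (β : ℍ[ℝ])).re = 0 := by rw [re_mul_coe, ht, zero_mul]
  have himag : ∀ {s : ℍ[ℝ]}, s.re = 0 → star s = -s ∧ s.im = s := by
    intro s hs
    constructor <;> ext <;> simp [hs]
  have key := im_sub_eq hf hinf hφ hF hF' (ζ := w <• (t * (β : ℍ[ℝ])))
    (u := w <• (1 - t * (β : ℍ[ℝ]))) (w := w) (w' := -w) (v := t) (v' := 0)
    (smul_ne_zero_of hw (one_sub_ne_zero ht')) (normSq_cayley ht') ?_ ?_ ?_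
  · rw [← op_smul_op_smul, map_coe_smul hF hF' h0, hr, op_smul_op_smul, hneg, herm_smul_left,
      sub_neg_eq_add, herm_add_right, herm_self, ← coe_add, im_sub,
      im_eq_im_zero hf hinf hφ hF hF' h0 w, im_eq_im_zero hf hinf hφ hF hF' h0 (-w), hφ0, sub_zero,
      mul_coe_eq_smul, mul_coe_eq_smul, Quaternion.star_smul, (himag hr0).1, im_smul, im_smul,
      im_neg, (himag hr0).2, smul_neg, smul_neg, smul_smul, ← neg_smul] at key
    rw [key]
    congr 1
    rw [hβ]
    field_simp
    ring
  · rw [MulOpposite.op_sub, sub_smul, MulOpposite.op_one, one_smul]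
    abel
  · rw [op_smul_op_smul, mul_neg, mul_inv_cancel_left₀ (one_sub_ne_zero ht'), MulOpposite.op_neg,
      neg_smul, MulOpposite.op_add, add_smul, MulOpposite.op_one, one_smul]
    abel
  · rw [sub_zero, sub_neg_eq_add, herm_smul_left, herm_add_right, herm_self, ← coe_add,
      (himag ht').1, mul_coe_eq_smul, mul_coe_eq_smul, im_smul, im_neg, im_smul, (himag ht).2,
      ← smul_neg, smul_smul, smul_neg, ← neg_smul, hβ]
    conv_lhs => rw [← one_smul ℝ t]
    congr 1
    field_simp
    ring

/-- Coordinate form of the main theorem for maps fixing `inf` and the origin. -/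
theorem exists_scalar_of_preservesChains (hm : 1 ≤ m) (hf : PreservesChains f) (hinf : f inf = inf)
    (hφ : ∀ w v, f (pt w v) = pt (F w) (φ w v)) (hF : PreservesSpheres F)
    (hF' : PreservesSpheres F.symm) (h0 : F 0 = 0) (hφ0 : (φ 0 0).im = 0) :
    ∃ (μ : ℝ) (a : ℍ[ℝ]), 0 < μ ∧ normSq a = 1 ∧
      (∀ (w : W m) (s : ℍ[ℝ]), F (w <• s) <• a = (F w <• a) <• s) ∧ (∀ w, nsq (F w) = μ * nsq w) ∧
      ∀ w v, (φ w v).im * a = μ • (a * v.im) := by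
  have hadd := map_add_of_preservesSpheres hF hF' h0
  have hFne : ∀ {w}, w ≠ 0 → F w ≠ 0 := by
    intro w hw
    rwa [← h0, F.injective.ne_iff]
  obtain ⟨w₀, hw₀⟩ : ∃ w : W m, w ≠ 0 :=
    ⟨fun _ => 1, fun h => one_ne_zero (congrFun h ⟨0, hm⟩)⟩
  set μ := nsq (F w₀) / nsq w₀ with hμ
  have hμ0 : 0 < μ := div_pos (nsq_pos (hFne hw₀)) (nsq_pos hw₀)
  have key : ∀ {w : W m}, w ≠ 0 → nsq (F w) / nsq w = μ := by
    intro w hw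
    -- The left side does not involve `w`, so the ratio of norms is the same for all vectors.
    have h1 : ∀ {w : W m}, w ≠ 0 → normSq (φ 0 qi).im = (nsq (F w) / nsq w) ^ 2 := by
      intro w hw
      obtain ⟨r, hr, h⟩ := exists_map_smul hF hF' h0 w qi
      rw [map_smul_eq hf hinf hφ hF hF' h0 hφ0 hw re_qi h, normSq_smul, hr, normSq_qi, mul_one]
    have h2 := (h1 hw).symm.trans (h1 hw₀)
    exact (pow_left_inj₀ (div_nonneg (nsq_nonneg _) (nsq_nonneg _)) hμ0.le two_ne_zero).1 h2
  -- By `map_smul_eq`, the scalar of `F` attached to an imaginary `t` is `μ⁻¹ • (φ 0 t).im`,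
  -- whichever `w` is used.
  set g : ℍ[ℝ] → ℍ[ℝ] := fun s => (s.re : ℍ[ℝ]) + μ⁻¹ • (φ 0 s.im).im with hg
  have hFg : ∀ (w : W m) (s : ℍ[ℝ]), F (w <• s) = F w <• g s := by
    intro w s
    rcases eq_or_ne w 0 with rfl | hw
    · rw [smul_zero, h0, smul_zero]
    obtain ⟨r, -, hr⟩ := exists_map_smul hF hF' h0 w s.im
    rw [hg]
    dsimp only
    rw [map_smul_eq hf hinf hφ hF hF' h0 hφ0 hw (re_im s) hr, key hw, inv_smul_smul₀ hμ0.ne',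
      MulOpposite.op_add, add_smul, ← hr, ← map_coe_smul hF hF' h0, ← hadd, ← add_smul,
      ← MulOpposite.op_add, re_add_im]
  have hg1 : ∀ t : ℝ, g t = t := by
    intro t
    simp [hg, hφ0]
  let G : ℍ[ℝ] →+* ℍ[ℝ] :=
    { toFun := g
      map_one' := by simpa using hg1 1
      map_zero' := by simpa using hg1 0
      map_mul' := fun s t => smul_left_cancel (hFne hw₀) (by
        rw [← hFg, ← op_smul_op_smul, hFg, hFg, op_smul_op_smul])
      map_add' := fun s t => smul_left_cancel (hFne hw₀) (by
        rw [← hFg, MulOpposite.op_add s t, add_smul, hadd, hFg, hFg, MulOpposite.op_add (g s),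
          add_smul]) }
  obtain ⟨a, ha, hGa⟩ := exists_conj G hg1
  refine ⟨μ, a, hμ0, ha, ?_, ?_, ?_⟩
  · intro w s
    rw [hFg, op_smul_op_smul, op_smul_op_smul]
    exact congrArg (fun z => F w <• z) (hGa s)
  · intro w
    rcases eq_or_ne w 0 with rfl | hw
    · simp [h0]
    · rw [← key hw, div_mul_cancel₀ _ (nsq_pos hw).ne']
  · intro w v
    have h1 : g v.im = μ⁻¹ • (φ 0 v.im).im := by simp [hg]
    have h2 : (φ 0 v.im).im = (φ 0 v).im := by
      have h3 : f (pt 0 v.im) = f (pt 0 v) := by rw [pt_im]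
      rw [hφ, hφ] at h3
      exact (pt_eq_pt_iff.1 h3).2
    rw [im_eq_im_zero hf hinf hφ hF hF' h0, ← h2, ← smul_inv_smul₀ hμ0.ne' (φ 0 v.im).im, ← h1,
      smul_mul_assoc]
    exact congrArg (fun z => μ • z) (hGa v.im)

end Coordinates

/-! ### Matrices, isometries of `q` and their action on the boundary. -/

/-- The linear automorphism defined by an invertible matrix. -/
noncomputable def linEquiv (g : GL (Fin (n + 1)) ℍ[ℝ]) : V n ≃ₗ[(ℍ[ℝ])ᵐᵒᵖ] V n where
  toFun v := (g : Matrix (Fin (n + 1)) (Fin (n + 1)) ℍ[ℝ]).mulVec v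
  invFun v := ((g⁻¹ : GL (Fin (n + 1)) ℍ[ℝ]) : Matrix (Fin (n + 1)) (Fin (n + 1)) ℍ[ℝ]).mulVec v
  map_add' := Matrix.mulVec_add _
  map_smul' s v := Matrix.mulVec_smul _ s v
  left_inv v := by
    simp only [Matrix.mulVec_mulVec, ← Units.val_mul, inv_mul_cancel, Units.val_one,
    Matrix.one_mulVec]
  right_inv v := by
    simp only [Matrix.mulVec_mulVec, ← Units.val_mul, mul_inv_cancel, Units.val_one,
    Matrix.one_mulVec]

theorem q_linEquiv (g : U n) (v : V n) : q (linEquiv (g : GL (Fin (n + 1)) ℍ[ℝ]) v) = q v := g.2 v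

theorem projAction_mk_eq (g : U n) (v : V n) (hv : v ≠ 0) :
    projAction n (g : PU n) (Projectivization.mk (ℍ[ℝ])ᵐᵒᵖ v hv) =
      Projectivization.mk (ℍ[ℝ])ᵐᵒᵖ (linEquiv (g : GL (Fin (n + 1)) ℍ[ℝ]) v)
        ((linEquiv (g : GL (Fin (n + 1)) ℍ[ℝ])).map_ne_zero_iff.2 hv) :=
  projAction_mk g v _ hv _ rfl

theorem projAction_mem_boundary_iff (g : U n) (x : P n) :
    projAction n (g : PU n) x ∈ boundary n ↔ x ∈ boundary n := by
  induction x using Projectivization.ind with | h v hv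
  rw [projAction_mk_eq, mk_mem_boundary, mk_mem_boundary, q_linEquiv]

/-- The action of `U n` on the boundary. -/
noncomputable def bdAction (g : U n) : boundary n ≃ boundary n :=
  (projAction n (g : PU n)).subtypePerm (projAction_mem_boundary_iff g)

theorem coe_bdAction (g : U n) (x : boundary n) :
    (bdAction g x : P n) = projAction n (g : PU n) x := rfl

theorem bdAction_mul (g h : U n) (x : boundary n) :
    bdAction (g * h) x = bdAction g (bdAction h x) := by
  apply Subtype.ext
  rw [coe_bdAction, coe_bdAction, coe_bdAction, QuotientGroup.mk_mul, map_mul, Equiv.Perm.mul_apply]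

theorem bdAction_one (x : boundary n) : bdAction 1 x = x := by
  apply Subtype.ext
  rw [coe_bdAction, QuotientGroup.mk_one, map_one, Equiv.Perm.one_apply]

theorem bdAction_inv_apply (g : U n) (x : boundary n) : bdAction g⁻¹ (bdAction g x) = x := by
  rw [← bdAction_mul, inv_mul_cancel, bdAction_one]

theorem preservesChains_bdAction (g : U n) : PreservesChains (bdAction g) := by
  rintro _ ⟨L, hL, ⟨x, hxL, hx⟩, rfl⟩
  set e := linEquiv (g : GL (Fin (n + 1)) ℍ[ℝ]) with he
  have hpts : ∀ x, projAction n (g : PU n) x ∈ points (L.map e.toLinearMap) ↔ x ∈ points L := by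
    intro x
    induction x using Projectivization.ind with | h v hv
    rw [projAction_mk_eq, mk_mem_points, mk_mem_points, ← he]
    exact e.injective.mem_set_image
  refine ⟨L.map e.toLinearMap, ?_, ⟨projAction n (g : PU n) x, (hpts x).2 hxL, ?_⟩, ?_⟩
  · rw [← hL]
    exact LinearEquiv.finrank_map_eq e L
  · induction x using Projectivization.ind with | h v hv
    rw [mk_mem_hyperbolicSpace] at hx
    rwa [projAction_mk_eq, mk_mem_hyperbolicSpace, q_linEquiv]
  · ext y
    obtain ⟨y, rfl⟩ := (bdAction g).surjective y
    rw [(bdAction g).injective.mem_set_image]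
    exact (hpts y).symm

/-- Nondegeneracy of `q`: the two non-zero test vectors isolate the norms of the last and first
coordinates. It makes `q`-preserving linear maps injective. -/
theorem eq_zero_of_forall_q_add {v : V (m + 1)} (h : ∀ x, q (v + x) = q x) : v = 0 := by
  have h0 := h 0
  have h1 := h (vec (v (Fin.last (m + 1))) 0 0)
  have h2 := h (vec 0 0 (v 0))
  rw [add_zero, ← vec_zero_zero_zero] at h0
  rw [← vec_eta v] at h0 h1 h2
  simp only [vec_last, vec_zero, vec_add, q_vec, add_zero, star_zero, zero_mul, re_zero,
    mul_zero, sub_zero, nsq_zero, star_add, add_mul, mul_add, re_add, star_mul_self,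
    re_coe] at h0 h1 h2
  have e1 : v (Fin.last (m + 1)) = 0 := by
    rw [← normSq_eq_zero]
    linarith
  have e2 : v 0 = 0 := by
    rw [← normSq_eq_zero]
    linarith
  rw [e1, mul_zero, re_zero, mul_zero, sub_zero, nsq_eq_zero] at h0
  rw [← vec_eta v, e1, e2, h0, vec_zero_zero_zero]

/-- A linear endomorphism preserving `q` is given by an element of `U (m + 1)`. -/
theorem exists_mulVec_eq (L : V (m + 1) →ₗ[(ℍ[ℝ])ᵐᵒᵖ] V (m + 1)) (hL : ∀ v, q (L v) = q v) :
    ∃ g : U (m + 1), ∀ v, linEquiv (g : GL (Fin (m + 1 + 1)) ℍ[ℝ]) v = L v := by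
  have hinj : Function.Injective L := by
    rw [injective_iff_map_eq_zero]
    intro v hv
    apply eq_zero_of_forall_q_add
    intro x
    rw [← hL, map_add, hv, zero_add, hL]
  let e := LinearEquiv.ofBijective L ⟨hinj, LinearMap.injective_iff_surjective.1 hinj⟩
  let M : (V (m + 1) →ₗ[(ℍ[ℝ])ᵐᵒᵖ] V (m + 1)) → Matrix (Fin (m + 1 + 1)) (Fin (m + 1 + 1)) ℍ[ℝ] :=
    fun L => Matrix.of fun i j => L (Pi.single j 1) i
  have hM : ∀ (L : V (m + 1) →ₗ[(ℍ[ℝ])ᵐᵒᵖ] V (m + 1)) (v : V (m + 1)), (M L).mulVec v = L v := by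
    intro L v
    have hv : v = ∑ j, (Pi.single j 1 : V (m + 1)) <• v j := by
      ext1 i
      simp [Finset.sum_apply, Pi.single_apply]
    conv_rhs => rw [hv]
    ext1 i
    rw [map_sum, Finset.sum_apply]
    simp [Matrix.mulVec, dotProduct, M]
  refine ⟨⟨⟨M e, M e.symm, ?_, ?_⟩, fun v => ?_⟩, fun v => ?_⟩
  · apply Matrix.ext_of_mulVec_single
    intro i
    rw [← Matrix.mulVec_mulVec, hM, hM, Matrix.one_mulVec]
    simp
  · apply Matrix.ext_of_mulVec_single
    intro i
    rw [← Matrix.mulVec_mulVec, hM, hM, Matrix.one_mulVec]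
    simp
  · exact (congrArg q (hM e v)).trans (hL v)
  · exact hM e v

theorem exists_bdAction (L : V (m + 1) →ₗ[(ℍ[ℝ])ᵐᵒᵖ] V (m + 1)) (hL : ∀ v, q (L v) = q v) :
    ∃ g : U (m + 1), ∀ (x y : boundary (m + 1)) (v w : V (m + 1)) (hv : v ≠ 0) (hw : w ≠ 0)
      (s : ℍ[ℝ]), x = Projectivization.mk (ℍ[ℝ])ᵐᵒᵖ v hv → y = Projectivization.mk (ℍ[ℝ])ᵐᵒᵖ w hw →
      L v = w <• s → bdAction g x = y := by
  obtain ⟨g, hg⟩ := exists_mulVec_eq L hL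
  refine ⟨g, fun x y v w hv hw s hx hy h => Subtype.ext ?_⟩
  rw [coe_bdAction, hx, hy, projAction_mk_eq, Projectivization.mk_eq_mk_iff', hg]
  exact ⟨_, h.symm⟩

/-! ### Translations, the swap of `inf` with the origin, and similarities. -/

/-- Heisenberg translations. -/
theorem exists_bdAction_translation (ζ : W m) (τ : ℍ[ℝ]) :
    ∃ g : U (m + 1), bdAction g inf = inf ∧ bdAction g (pt 0 0) = pt ζ τ := by
  -- The first coordinate of `ptVec ζ τ`; its real part is what makes the map preserve `q`.
  set c : ℍ[ℝ] := (nsq ζ / 2 : ℝ) + τ.im with hc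
  have hre : (star c).re = nsq ζ / 2 := by rw [hc, re_star, re_add, re_coe, re_im, add_zero]
  obtain ⟨g, hg⟩ := exists_bdAction (m := m)
    { toFun := fun v => vec (v 0 + herm ζ (mid v) + c * v (Fin.last (m + 1)))
        (mid v + ζ <• v (Fin.last (m + 1))) (v (Fin.last (m + 1)))
      map_add' := fun v w => by
        rw [vec_add, vec_inj, mid_add, herm_add_right, Pi.add_apply, Pi.add_apply, mul_add,
          MulOpposite.op_add, add_smul]
        exact ⟨by abel, by abel, rfl⟩
      map_smul' := fun s v => by
        obtain ⟨s, rfl⟩ := MulOpposite.op_surjective s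
        rw [RingHom.id_apply, vec_smul, mid_smul, herm_smul_right, Pi.smul_apply, Pi.smul_apply,
          MulOpposite.smul_eq_mul_unop, MulOpposite.smul_eq_mul_unop, MulOpposite.unop_op,
          smul_add, op_smul_op_smul, add_mul (v 0 + _), add_mul (v 0), mul_assoc c] }
    (fun v => by
      have h : ∀ b : ℍ[ℝ], (star b * star c * b).re = (star c).re * normSq b := by
        intro b
        simp [normSq_def']
        ring
      simp only [LinearMap.coe_mk, AddHom.coe_mk]
      rw [q_vec, q_eq, nsq_add, nsq_smul, star_add, star_add, star_herm, add_mul, add_mul, re_add,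
        re_add, star_mul, h, hre, herm_smul_right]
      ring)
  refine ⟨g, hg _ _ _ _ infVec_ne_zero infVec_ne_zero 1 rfl rfl ?_,
    hg _ _ _ _ (ptVec_ne_zero _ _) (ptVec_ne_zero _ _) 1 rfl rfl ?_⟩
  · simp
  · simp [ptVec, hc]

theorem exists_bdAction_swap : ∃ g : U (m + 1), bdAction g inf = pt 0 0 := by
  obtain ⟨g, hg⟩ := exists_bdAction (m := m)
    { toFun := fun v => vec (v (Fin.last (m + 1))) (mid v) (v 0)
      map_add' := fun v w => by rw [vec_add, mid_add]; rfl
      map_smul' := fun s v => by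
        obtain ⟨s, rfl⟩ := MulOpposite.op_surjective s
        rw [RingHom.id_apply, vec_smul, mid_smul]
        rfl }
    (fun v => by
      simp only [LinearMap.coe_mk, AddHom.coe_mk]
      rw [q_vec, q_eq, ← re_star, star_mul, star_star])
  refine ⟨g, hg _ _ _ _ infVec_ne_zero (ptVec_ne_zero _ _) 1 rfl rfl ?_⟩
  simp [ptVec]

theorem exists_bdAction_inf_eq (x : boundary (m + 1)) : ∃ g : U (m + 1), bdAction g inf = x := by
  rcases eq_inf_or_eq_pt x with rfl | ⟨w, v, rfl⟩
  · exact ⟨1, bdAction_one inf⟩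
  · obtain ⟨g, -, hg⟩ := exists_bdAction_translation w v
    obtain ⟨h, hh⟩ := exists_bdAction_swap (m := m)
    exact ⟨g * h, by rw [bdAction_mul, hh, hg]⟩

theorem nsq_real_smul (r : ℝ) (w : W m) : nsq (r • w) = r ^ 2 * nsq w := by
  simp [nsq, Finset.mul_sum, normSq_smul]

/-- Right multiplication by `a` turns `F` into a linear map. Factors `r⁻¹`, on the middle and last
coordinates, and `r`, on the first, with `r = √μ`, make the block map an isometry; dividing by the
last coordinate `r⁻¹ • a` gives the stated action. -/
theorem exists_bdAction_similarity {F : W m → W m} {μ : ℝ} {a : ℍ[ℝ]} (hμ : 0 < μ)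
    (ha : normSq a = 1) (hadd : ∀ x y, F (x + y) = F x + F y)
    (hsmul : ∀ (w : W m) (s : ℍ[ℝ]), F (w <• s) <• a = (F w <• a) <• s)
    (hnsq : ∀ w, nsq (F w) = μ * nsq w) :
    ∃ g : U (m + 1), bdAction g inf = inf ∧
      ∀ w v v', v'.im * a = μ • (a * v.im) → bdAction g (pt w v) = pt (F w) v' := by
  set r := √μ with hr
  have hr0 : r ≠ 0 := (Real.sqrt_pos.2 hμ).ne'
  have hr2 : r ^ 2 = μ := Real.sq_sqrt hμ.le
  have ha0 : a ≠ 0 := by rintro rfl; simp at ha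
  obtain ⟨g, hg⟩ := exists_bdAction (m := m)
    { toFun := fun v => vec (r • (a * v 0)) (r⁻¹ • (F (mid v) <• a))
        (r⁻¹ • (a * v (Fin.last (m + 1))))
      map_add' := fun v w => by
        rw [vec_add, mid_add, hadd, Pi.add_apply, Pi.add_apply, mul_add, mul_add, smul_add,
          smul_add, smul_add, smul_add]
      map_smul' := fun s v => by
        obtain ⟨s, rfl⟩ := MulOpposite.op_surjective s
        rw [RingHom.id_apply, vec_smul, mid_smul, Pi.smul_apply, Pi.smul_apply, hsmul,
          MulOpposite.smul_eq_mul_unop, MulOpposite.smul_eq_mul_unop, MulOpposite.unop_op,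
          smul_comm (MulOpposite.op s) r⁻¹, smul_mul_assoc, smul_mul_assoc, mul_assoc, mul_assoc] }
    (fun v => by
      simp only [LinearMap.coe_mk, AddHom.coe_mk]
      rw [q_vec, q_eq, nsq_real_smul, nsq_smul, hnsq, ha, Quaternion.star_smul, star_mul,
        smul_mul_smul_comm, mul_inv_cancel₀ hr0, one_smul, ← mul_assoc _ a, mul_assoc _ (star a) a,
        star_mul_self, ha, coe_one, mul_one, mul_one, ← hr2]
      field_simp)
  refine ⟨g, hg _ _ _ _ infVec_ne_zero infVec_ne_zero (r • a) rfl rfl ?_, fun w v v' h =>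
    hg _ _ _ _ (ptVec_ne_zero _ _) (ptVec_ne_zero _ _) (r⁻¹ • a) rfl rfl ?_⟩
  · have hF0 : F 0 = 0 := by simpa using hadd 0 0
    simp only [LinearMap.coe_mk, AddHom.coe_mk]
    rw [vec_smul, vec_inj]
    simp [hF0]
  · simp only [LinearMap.coe_mk, AddHom.coe_mk, ptVec, vec_zero, vec_last, mid_vec]
    rw [vec_smul, vec_inj, one_mul, mul_one]
    refine ⟨?_, ?_, rfl⟩
    · rw [mul_smul_comm, add_mul, h, hnsq, mul_add, ← coe_commutes, coe_mul_eq_smul, coe_mul_eq_smul,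
        smul_add, smul_add, smul_smul, smul_smul, smul_smul, ← hr2]
      congr 2 <;> field_simp
    · ext1 i
      simp

end QuatHyp

/-! ### The main theorem. -/

theorem theorem3p2 (n : ℕ) (hn : 2 ≤ n)
    (f : QuatHyp.boundary n → QuatHyp.boundary n) (hf : Function.Bijective f)
    (hchain : ∀ C : Set (QuatHyp.boundary n), QuatHyp.IsChain C → QuatHyp.IsChain (f '' C)) :
    ∃ g : QuatHyp.PU n, ∀ x : QuatHyp.boundary n,
      (f x : QuatHyp.P n) = QuatHyp.projAction n g (x : QuatHyp.P n) := by
  open QuatHyp in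
  obtain ⟨m, rfl⟩ : ∃ m, n = m + 1 := ⟨n - 1, by omega⟩
  -- Normalisation: `g₁⁻¹` returns `f inf` to `inf`, and `g₂⁻¹` then returns the image of the origin
  -- while fixing `inf`.
  obtain ⟨g₁, hg₁⟩ := exists_bdAction_inf_eq (f inf)
  obtain ⟨w, v, hwv⟩ : ∃ w v, bdAction g₁⁻¹ (f (pt 0 0)) = pt w v := by
    refine (eq_inf_or_eq_pt _).resolve_left fun h => ?_
    rw [← bdAction_inv_apply g₁ inf, hg₁, (bdAction g₁⁻¹).apply_eq_iff_eq, hf.1.eq_iff] at h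
    exact pt_ne_inf _ _ h
  obtain ⟨g₂, hg₂, hg₂'⟩ := exists_bdAction_translation w v
  let f' : boundary (m + 1) ≃ boundary (m + 1) :=
    (Equiv.ofBijective f hf).trans ((bdAction g₁⁻¹).trans (bdAction g₂⁻¹))
  have hf' : ∀ x, f' x = bdAction g₂⁻¹ (bdAction g₁⁻¹ (f x)) := fun _ => rfl
  have hchain' : PreservesChains f' := by
    intro C hC
    have := preservesChains_bdAction g₂⁻¹ _ (preservesChains_bdAction g₁⁻¹ _ (hchain C hC))
    rwa [← Set.image_comp, ← Set.image_comp] at this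
  have hinf : f' inf = inf := by
    rw [hf', ← hg₁, bdAction_inv_apply, ← hg₂, bdAction_inv_apply, hg₂]
  have hzero : f' (pt 0 0) = pt 0 0 := by rw [hf', hwv, ← hg₂', bdAction_inv_apply]
  obtain ⟨F, φ, φ', hφ, hφ'⟩ := hchain'.exists_coordinates hinf
  have hinf' : f'.symm inf = inf := by rw [f'.symm_apply_eq, hinf]
  have hF := preservesSpheres hchain' hinf hφ
  have hF' := preservesSpheres hchain'.symm hinf' hφ'
  rw [hφ, pt_eq_pt_iff] at hzero
  obtain ⟨μ, a, hμ, ha, hsmul, hnsq, hv⟩ := exists_scalar_of_preservesChains (by omega) hchain' hinf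
    hφ hF hF' hzero.1 hzero.2
  obtain ⟨h, h₁, h₂⟩ := exists_bdAction_similarity hμ ha
    (map_add_of_preservesSpheres hF hF' hzero.1) hsmul hnsq
  have key : ∀ x, f' x = bdAction h x := by
    intro x
    rcases eq_inf_or_eq_pt x with rfl | ⟨w, v, rfl⟩
    · rw [h₁, hinf]
    · rw [hφ, h₂ w v _ (hv w v)]
  refine ⟨(g₁ * g₂ * h : U (m + 1)), fun x => ?_⟩
  rw [← coe_bdAction, bdAction_mul, ← key, hf', ← bdAction_mul, ← bdAction_mul]
  simp [bdAction_one]
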